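/- Let $\alpha>1/2$ and $\beta\in(1/2,\,1/2+\alpha)$. **Setting.** Let $\mathcal H$ be a reproducing kernel Hilbert space of real functions on a set $\mathcal X$ with kernel $K$, let $x_1,\dots,x_n\in\mathcal X$ (source covariates) and $\tilde x_1,\dots,\tilde x_m\in\mathcal X$ (target covariates) be fixed, and write $K_{nn}=(K(x_i,x_{i'}))$, $K_{mn}=(K(\tilde x_j,x_i))$, $\tilde K_{mm}=(K(\tilde x_j,\tilde x_{j'}))$. We observe $y_i=f^*(x_i)+w_i$, $i=1,\dots,n$, where $f^*\in\mathcal H$ and the $w_i$ are independent with mean zero and variance $\sigma^2>0$. The $\lambda$-biased kernel ridge teacher is the matrix $T_\lambda=K_{mn}(K_{nn}+\lambda n I)^{-1}$. For $\gamma>0$: * the RaT (residual-as-teacher) estimate $\hat f^{\gamma}_{\mathrm{RaT}}$ is the fixed point $f\in\mathcal H$ of $$f=\arg\min_{g\in\mathcal H}\Big\{\tfrac1{2\eta}\sum_{j=1}^m\big(u_j-g(\tilde x_j)\big)^2+\tfrac{\gamma m}{2}\|g\|_{\mathcal H}^2\Big\},\qquad u_j=f(\tilde x_j)-\eta\,\big[T_\lambda\big((f(x_i)-y_i)_{i=1}^n\big)\big]_j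 ,$$ where $\eta>0$ is any stepsize; * the SM (soft-matching) estimate is $\hat f^{\gamma}_{\mathrm{SM}}=\arg\min_{g\in\mathcal H}\big\{\tfrac12\sum_{j=1}^m(g(\tilde x_j)-[T_\lambda y]_j)^2+\tfrac{\gamma m}{2}\|g\|_{\mathcal H}^2\big\}$. For an estimate $\hat f$ put $\|\hat f-f^*\|_m^2=\frac1m\sum_{j=1}^m(\hat f(\tilde x_j)-f^*(\tilde x_j))^2$. The pair $(K_{nn},\tilde K_{mm})$ exhibits $(\alpha,\beta)$-eigendecay with constants $0<a\le b$ if the $j$-th largest eigenvalue of $\frac1nK_{nn}$ lies in $[a\,j^{-2\alpha},\,b\,j^{-2\alpha}]$ for $1\le j\le n$ and that of $\frac1m\tilde K_{mm}$ lies in $[a\,j^{-2\beta},\,b\,j^{-2\beta}]$ for $1\le j\le m$. **Theorem.** There are constants $0<a\le b$ and $c,c_2>0$ depending only on $(\alpha,\beta)$ and, for every $\lambda>0$, constants $c_0,c_1>0$ depending only on $(\alpha,\beta,\lambda)$, such that the following holds. For every $\lambda>0$, every integer $n\ge\lambda^{-1-\frac1{2\alpha}}$ and every integer $1\le m\le n$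 there exist a reproducing kernel Hilbert space $\mathcal H$ and source and target covariates $(x_i)_{i=1}^n$, $(\tilde x_j)_{j=1}^m$ for which $(K_{nn},\tilde K_{mm})$ exhibits $(\alpha,\beta)$-eigendecay with constants $a,b$, for which the RaT and SM estimates exist and are unique for all $\gamma,\eta>0$ and all $y\in\mathbb R^n$, and such that for all $R\ge1$ and $\sigma>0$: 1. (RaT upper bound) with $\gamma=\frac1\lambda\big(\frac{\sigma^2}{R^2n}\big)^{\frac{2(\alpha+\beta)}{2\alpha+1}}$ (and any stepsize $\eta>0$), $$\sup_{\|f^*\|_{\mathcal H}\le R}\mathbb E_w\|\hat f^{\gamma}_{\mathrm{RaT}}-f^*\|_m^2\le c_0R^2\Big(\frac{\sigma^2}{nR^2}\Big)^{\frac{2\beta}{2\alpha+1}},$$ and, if $\sigma\le R$, the same bound holds with $c$ in place of $c_0$; 2. (SM lower bound) $$\sup_{\|f^*\|_{\mathcal H}\le R}\ \inf_{\gamma>0}\ \mathbb E_w\|\hat f^{\gamma}_{\mathrm{SM}}-f^*\|_m^2\ge c_1R^2>0;$$ 3. (minimax lower bound) if moreover $m=n\ge(R^2/\sigma^2)^{\frac1{2\alpha}}$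 and the noise is Gaussian, $w_i\sim N(0,\sigma^2)$ i.i.d., then every estimator $\hat f$, that is, every measurable function of the labeled source sample and the unlabeled target covariates, satisfies $$\sup_{\|f^*\|_{\mathcal H}\le R}\mathbb E_w\|\hat f-f^*\|_m^2\ge c_2\min\Big\{R^2\Big(\frac{\sigma^2}{nR^2}\Big)^{\frac{2\beta}{2\alpha+1}},\,R^2\Big\}.$$ -/

import Mathlib

open MeasureTheory ProbabilityTheory Matrix
open scoped ENNReal

namespace KernelTransfer

noncomputable section

/-! ### Kernel matrices and the kernel ridge teacher -/

section Kernel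

variable {X : Type*} (H : Type*) [NormedAddCommGroup H] [InnerProductSpace ℝ H]
  [CompleteSpace H] [RKHS ℝ H X ℝ]

/-- The real-valued reproducing kernel of the RKHS `H` of real functions on `X`. (In Mathlib the
kernel takes values in the continuous linear maps `ℝ → ℝ`, that is, in multiplications by a real
number; evaluating at `1` gives that number.) -/
def kernelFn (s t : X) : ℝ := RKHS.kernel H s t 1

/-- The kernel matrix with `(i, j)` entry `K (s i, t j)`. -/
def kernelMatrix {p q : ℕ} (s : Fin p → X) (t : Fin q → X) : Matrix (Fin p) (Fin q) ℝ :=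
  Matrix.of fun i j => kernelFn H (s i) (t j)

/-- The `lam`-biased kernel ridge teacher matrix
`T = K_{mn} (K_{nn} + lam * n * I)⁻¹`, sending source responses to predictions at the target
covariates. -/
def ridgeTeacher {n m : ℕ} (x : Fin n → X) (xt : Fin m → X) (lam : ℝ) :
    Matrix (Fin m) (Fin n) ℝ :=
  kernelMatrix H xt x *
    (kernelMatrix H x x + (lam * (n : ℝ)) • (1 : Matrix (Fin n) (Fin n) ℝ))⁻¹

end Kernel

/-- A symmetric real matrix exhibits polynomial eigendecay with exponent `α` and constants
`a ≤ b`: its eigenvalues, listed with multiplicity in decreasing order `σ₁ ≥ σ₂ ≥ …`, satisfy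
`a * j ^ (-2 α) ≤ σ_j ≤ b * j ^ (-2 α)` for every `j` (the index below is `j - 1`). -/
def HasEigendecay {p : ℕ} (A : Matrix (Fin p) (Fin p) ℝ) (α a b : ℝ) : Prop :=
  ∃ hA : A.IsHermitian, ∀ j : Fin (Fintype.card (Fin p)),
    a * ((j : ℝ) + 1) ^ (-2 * α) ≤ hA.eigenvalues₀ j ∧
      hA.eigenvalues₀ j ≤ b * ((j : ℝ) + 1) ^ (-2 * α)

/-! ### Student estimators with least-squares loss and penalty `(γ m / 2) ‖f‖²` -/

section Students

variable {X : Type*} {H : Type*} [NormedAddCommGroup H] [InnerProductSpace ℝ H]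
  [RKHS ℝ H X ℝ]

/-- `f` is the student proximal update at `u`: it minimizes
`g ↦ (1 / (2 η)) ‖u - g(xt)‖₂² + (γ m / 2) ‖g‖²` over the RKHS. -/
def IsProxUpdate {m : ℕ} (xt : Fin m → X) (γ η : ℝ) (u : Fin m → ℝ) (f : H) : Prop :=
  IsMinOn (fun g : H => 1 / (2 * η) * ∑ j, (u j - g (xt j)) ^ 2 + γ * (m : ℝ) / 2 * ‖g‖ ^ 2)
    Set.univ f

/-- The teacher's surrogate gradient: the teacher applied to the source residuals
`f (x i) - y i`, evaluated at the target covariates. -/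
def gradHat {n m : ℕ} (T : Matrix (Fin m) (Fin n) ℝ) (x : Fin n → X) (y : Fin n → ℝ) (f : H) :
    Fin m → ℝ :=
  T *ᵥ fun i => f (x i) - y i

/-- `f` is a residual-as-teacher estimate: a fixed point of "compute the teacher's surrogate
gradient at `f`, take a gradient step of size `η` on the fitted target values, apply the student
proximal update". -/
def IsRaTEstimate {n m : ℕ} (T : Matrix (Fin m) (Fin n) ℝ) (x : Fin n → X) (xt : Fin m → X)
    (γ η : ℝ) (y : Fin n → ℝ) (f : H) : Prop :=
  IsProxUpdate xt γ η (fun j => f (xt j) - η * gradHat T x y f j) f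

/-- `f` is a student soft-matching estimate: the penalized least-squares fit of the student to
the teacher's pseudo-responses `T y` at the target covariates. -/
def IsSMEstimate {n m : ℕ} (T : Matrix (Fin m) (Fin n) ℝ) (xt : Fin m → X)
    (γ : ℝ) (y : Fin n → ℝ) (f : H) : Prop :=
  IsMinOn (fun g : H =>
      ∑ j, 1 / 2 * (g (xt j) - (T *ᵥ y) j) ^ 2 + γ * (m : ℝ) / 2 * ‖g‖ ^ 2)
    Set.univ f

end Students

/-! ### Noise and mean-squared error -/

/-- `ν` is a law on `ℝ` with mean zero and (finite) variance `σ²`. -/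
def IsNoiseLaw (ν : Measure ℝ) (σ : ℝ) : Prop :=
  IsProbabilityMeasure ν ∧ MemLp id 2 ν ∧ ∫ t, t ∂ν = 0 ∧ variance id ν = σ ^ 2

/-- The mean-squared error `E_w [(1/m) ∑ j, (fhat (xt j) - fstar (xt j))²]` of the estimator
`fhat`, a function of the responses `y i = fstar (x i) + w i`, where the noise variables `w i` are
independent with laws `ν i`. It is an extended nonnegative number. -/
def mse {X : Type*} {n m : ℕ} (ν : Fin n → Measure ℝ) (x : Fin n → X) (xt : Fin m → X)
    (fhat : (Fin n → ℝ) → X → ℝ) (fstar : X → ℝ) : ℝ≥0∞ :=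
  ∫⁻ w, ENNReal.ofReal
      (1 / (m : ℝ) * ∑ j, (fhat (fun i => fstar (x i) + w i) (xt j) - fstar (xt j)) ^ 2)
    ∂(Measure.pi ν)

end

end KernelTransfer

/-!
The witness is a diagonal design: `ℝⁿ` as an RKHS with the inner product as kernel, source points
`√n i ^ (-α) eᵢ` and target points `√m j ^ (-β) eⱼ`. All kernel matrices are then diagonal, the
normal equations decouple (`IsDiagonalDesign.isMinOn_ridge_iff_coord`), and the problem becomes a
sequence model: coordinate `θ_j` of the signal is observed with variance
`σ² j ^ (2 α) / n`, and the error is `∑_{j ≤ m} j ^ (-2 β) (θhat_j - θ_j)²`. RaT and SM multiply each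
observation by a shrinkage weight, so that their errors split exactly into squared bias and variance
(`IsDiagonalDesign.mse_eq`). Everything is governed by the cutoff `J` with
`σ² / (R² n) = J ^ (-(2 α + 1))`, and the target rate is `R² J ^ (-2 β)`.

* RaT shrinks by `A_j / (γ + A_j)` with `A_j = j ^ (-2 (α + β)) / (j ^ (-2 α) + lam)`. The fixed point
  removes the bias of the teacher: with `γ = J ^ (-2 (α + β)) / lam` the factor is close to `1` below
  `J` and decays polynomially above it. The variance is a truncated power sum
  (`exists_sum_rpow_mul_min_le`; here `β < 1/2 + α` enters), and the squared bias is
  `R² J ^ (-2 β) (1 + min(1, J ^ (-2 α)) / lam)` at most. If `σ ≤ R`, the lower bound on `n` gives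
  `J ^ (-2 α) ≤ lam`, and the constant no longer depends on `lam`.
* SM fits the responses of the teacher, which are shrunk by `1 / (1 + lam)` in the leading direction;
  a further penalty can only shrink them more, and the error there is at least
  `(lam / (1 + lam))² R²` (`IsDiagonalDesign.le_iSup_iInf_mse_sm`).
* The minimax bound is Assouad's (`hypercube_lower_bound`) with signs on the coordinates between
  `k / 2` and `k`, `k = ⌈J⌉`, each of size about `R / √k`. The signal-to-noise ratio of each
  coordinate is then at most `1`, and the two-point bound (`two_point_lower_bound`) follows from a
  lower bound on both Gaussian densities over `[-σ, σ]`.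
-/

namespace KernelTransfer

/-! ### Eigenvalues of a diagonal matrix -/

/-- The decreasingly ordered eigenvalues of a diagonal matrix with antitone diagonal `d` are the
entries of `d`: both lists are the sorted roots of the characteristic polynomial. -/
theorem eigenvalues₀_diagonal {p : ℕ} {d : Fin p → ℝ} (hd : Antitone d)
    (hA : (Matrix.diagonal d).IsHermitian) (j : Fin (Fintype.card (Fin p))) :
    hA.eigenvalues₀ j = d (j.cast (Fintype.card_fin p)) := by
  have hroots : (Matrix.diagonal d).charpoly.roots = (List.ofFn d : Multiset ℝ) := by
    rw [Matrix.charpoly_diagonal, Polynomial.roots_prod _ _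
      (Finset.prod_ne_zero_iff.2 fun i _ => Polynomial.X_sub_C_ne_zero _)]
    simp [Polynomial.roots_X_sub_C, Fin.univ_val_map]
  have h := hA.sort_roots_charpoly_eq_eigenvalues₀
  rw [hroots] at h
  have hmap : Multiset.map (RCLike.re : ℝ → ℝ) (List.ofFn d : Multiset ℝ) = (List.ofFn d) := by
    simp [Function.comp_def]
  have hs : (List.ofFn d).Pairwise (· ≥ ·) := hd.sortedGE_ofFn.pairwise
  rw [hmap, Multiset.coe_sort, List.mergeSort_eq_self _ hs] at h
  have hj : (j : ℕ) < (List.ofFn hA.eigenvalues₀).length := by simpa using j.2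
  have hj' : (j : ℕ) < (List.ofFn d).length := by simpa using j.2
  have h2 : (List.ofFn hA.eigenvalues₀)[(j : ℕ)] = (List.ofFn d)[(j : ℕ)] := by
    simp only [h]
  rw [List.getElem_ofFn, List.getElem_ofFn] at h2
  exact h2

theorem hasEigendecay_diagonal (p : ℕ) {α : ℝ} (hα : 0 ≤ α) :
    HasEigendecay (Matrix.diagonal fun j : Fin p => ((j : ℝ) + 1) ^ (-2 * α)) α 1 1 := by
  have hA : (Matrix.diagonal fun j : Fin p => ((j : ℝ) + 1) ^ (-2 * α)).IsHermitian :=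
    Matrix.isHermitian_diagonal _
  have hd : Antitone fun j : Fin p => ((j : ℝ) + 1) ^ (-2 * α) := by
    intro i j hij
    have : (i : ℝ) ≤ j := by exact_mod_cast hij
    exact Real.rpow_le_rpow_of_nonpos (by positivity) (by linarith) (by linarith)
  refine ⟨hA, fun j => ?_⟩
  rw [eigenvalues₀_diagonal hd hA]
  simp

/-! ### Power sums truncated at a real scale -/

/-- Bernoulli's inequality as a telescoping bound: for `0 ≤ r ≤ 1` the increment of `t ^ r` over
`[t, t + 1]` is at least `r (t + 1) ^ (r - 1)`. -/
theorem mul_rpow_sub_one_le_sub {t r : ℝ} (ht : 0 ≤ t) (hr : 0 ≤ r) (hr1 : r ≤ 1) :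
    r * (t + 1) ^ (r - 1) ≤ (t + 1) ^ r - t ^ r := by
  have h0 : 0 < t + 1 := by linarith
  have h1 := rpow_one_add_le_one_add_mul_self (s := -1 / (t + 1)) (p := r)
    (by rw [le_div_iff₀ h0]; linarith) hr hr1
  have h2 : 1 + -1 / (t + 1) = t / (t + 1) := by field_simp; ring
  rw [h2, Real.div_rpow ht h0.le, div_le_iff₀ (Real.rpow_pos_of_pos h0 r)] at h1
  rw [Real.rpow_sub_one h0.ne']
  have : r * ((t + 1) ^ r / (t + 1)) = r * (1 / (t + 1)) * (t + 1) ^ r := by ring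
  rw [this]
  have : (1 + r * (-1 / (t + 1))) * (t + 1) ^ r
    = (t + 1) ^ r - r * (1 / (t + 1)) * (t + 1) ^ r := by ring
  linarith

/-- The companion telescoping bound for negative powers. -/
theorem mul_rpow_neg_sub_one_le_sub {t s : ℝ} (ht : 1 ≤ t) (hs : 0 ≤ s) (hs1 : s ≤ 1) :
    s / 2 * t ^ (-s - 1) ≤ t ^ (-s) - (t + 1) ^ (-s) := by
  have h0 : 0 < t + 1 := by linarith
  have ht0 : 0 < t := by linarith
  have h1 := rpow_one_add_le_one_add_mul_self (s := -1 / (t + 1)) (p := s)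
    (by rw [le_div_iff₀ h0]; linarith) hs hs1
  have h2 : 1 + -1 / (t + 1) = t / (t + 1) := by field_simp; ring
  rw [h2, Real.div_rpow ht0.le h0.le] at h1
  have h3 : 1 / (2 * t) ≤ 1 / (t + 1) := by
    apply one_div_le_one_div_of_le h0; linarith
  rw [Real.rpow_sub_one ht0.ne', Real.rpow_neg h0.le, Real.rpow_neg ht0.le]
  have hp := Real.rpow_pos_of_pos ht0 s
  have h4 : t ^ s / (t + 1) ^ s ≤ 1 - s * (1 / (2 * t)) := by
    have : s * (-1 / (t + 1)) = - (s * (1 / (t + 1))) := by ring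
    nlinarith [mul_le_mul_of_nonneg_left h3 hs]
  have h5 : ((t + 1) ^ s)⁻¹ ≤ (1 - s * (1 / (2 * t))) * (t ^ s)⁻¹ := by
    rw [← div_eq_mul_inv, le_div_iff₀ hp]
    calc _ = t ^ s / (t + 1) ^ s := by ring
      _ ≤ _ := h4
  have h6 : (1 - s * (1 / (2 * t))) * (t ^ s)⁻¹ = (t ^ s)⁻¹ - s / 2 * ((t ^ s)⁻¹ / t) := by
    field_simp
  linarith

/-- The sum `∑ j ^ p min(1, (J / j) ^ k)`, where `p > -1` makes the head and `k > p + 1` the tail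
summable, is of the order `J ^ (p + 1)`, for every real scale `J > 0` and every length `m`. -/
theorem exists_sum_rpow_mul_min_le {p k : ℝ} (hp : -1 < p) (hk : p + 1 < k) :
    ∃ C : ℝ, 0 < C ∧ ∀ (J : ℝ) (m : ℕ), 0 < J →
      ∑ j ∈ Finset.range m, ((j : ℝ) + 1) ^ p * min 1 ((J / ((j : ℝ) + 1)) ^ k)
        ≤ C * J ^ (p + 1) := by
  set r := min 1 (p + 1) with hr
  set s := min 1 (k - p - 1) with hs
  have hr0 : 0 < r := lt_min one_pos (by linarith)
  have hs0 : 0 < s := lt_min one_pos (by linarith)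
  have hr1 : r ≤ 1 := min_le_left _ _
  have hs1 : s ≤ 1 := min_le_left _ _
  have hrp : r ≤ p + 1 := min_le_right _ _
  have hsk : s ≤ k - p - 1 := min_le_right _ _
  refine ⟨1 / r + 2 / s, by positivity, fun J m hJ => ?_⟩
  -- the potential: a head part that grows up to `J` and a tail part that is spent beyond `J`
  have key : ∑ j ∈ Finset.range m, ((j : ℝ) + 1) ^ p * min 1 ((J / ((j : ℝ) + 1)) ^ k)
      ≤ 1 / r * J ^ (p + 1 - r) * (min (m : ℝ) J) ^ r
        + 2 / s * J ^ (p + 1 + s) * (J ^ (-s) - (max ((m : ℝ) + 1) J) ^ (-s)) := by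
    induction m with
    | zero =>
      have h1 : (max ((0 : ℕ) + 1 : ℝ) J) ^ (-s) ≤ J ^ (-s) :=
        Real.rpow_le_rpow_of_nonpos hJ (le_max_right _ _) (by linarith)
      have h2 : 0 ≤ min ((0 : ℕ) : ℝ) J := le_min (by simp) hJ.le
      simp only [Finset.range_zero, Finset.sum_empty]
      have := sub_nonneg.2 h1
      positivity
    | succ m ih =>
      rw [Finset.sum_range_succ]
      refine (add_le_add_left ih _).trans ?_
      have hm1 : (1 : ℝ) ≤ (m : ℝ) + 1 := by linarith [Nat.cast_nonneg (α := ℝ) m]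
      have hm0 : (0 : ℝ) < (m : ℝ) + 1 := by linarith
      push_cast
      set t : ℝ := (m : ℝ) with htdef
      have ht0 : 0 ≤ t := Nat.cast_nonneg m
      rcases le_or_gt (t + 1) J with h | h
      · have e1 : max (t + 1) J = J := max_eq_right h
        have e2 : min t J = t := min_eq_left (by linarith)
        have e3 : min (t + 1) J = t + 1 := min_eq_left h
        have h1 : (max (t + 1 + 1) J) ^ (-s) ≤ J ^ (-s) :=
          Real.rpow_le_rpow_of_nonpos hJ (le_max_right _ _) (by linarith)
        have h2 : (t + 1) ^ p * min 1 ((J / (t + 1)) ^ k) ≤ (t + 1) ^ p :=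
          mul_le_of_le_one_right (by positivity) (min_le_left _ _)
        have h3 : (t + 1) ^ p ≤ J ^ (p + 1 - r) * (t + 1) ^ (r - 1) := by
          have : (t + 1) ^ p = (t + 1) ^ (p + 1 - r) * (t + 1) ^ (r - 1) := by
            rw [← Real.rpow_add hm0]; congr 1; ring
          rw [this]
          gcongr
        have h4 := mul_rpow_sub_one_le_sub ht0 hr0.le hr1
        have h5 : (t + 1) ^ p ≤ 1 / r * J ^ (p + 1 - r) * ((t + 1) ^ r - t ^ r) := by
          calc (t + 1) ^ p ≤ 1 / r * J ^ (p + 1 - r) * (r * (t + 1) ^ (r - 1)) := by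
                refine h3.trans_eq ?_; field_simp
            _ ≤ _ := by gcongr
        rw [e1, e2, e3, sub_self, mul_zero, add_zero]
        have h6 := mul_nonneg (by positivity : 0 ≤ 2 / s * J ^ (p + 1 + s)) (sub_nonneg.2 h1)
        linarith
      · have e1 : max (t + 1) J = t + 1 := max_eq_left h.le
        have e4 : max (t + 1 + 1) J = t + 1 + 1 := max_eq_left (by linarith)
        have h1 : (min t J) ^ r ≤ (min (t + 1) J) ^ r := by
          apply Real.rpow_le_rpow (le_min ht0 hJ.le) _ hr0.le
          exact min_le_min_right _ (by linarith)
        have hq : J / (t + 1) ≤ 1 := (div_le_one hm0).2 h.le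
        have h2 : (t + 1) ^ p * min 1 ((J / (t + 1)) ^ k)
            ≤ J ^ (p + 1 + s) * (t + 1) ^ (-s - 1) := by
          calc (t + 1) ^ p * min 1 ((J / (t + 1)) ^ k)
              ≤ (t + 1) ^ p * (J / (t + 1)) ^ (p + 1 + s) := by
                gcongr
                refine (min_le_right _ _).trans ?_
                exact Real.rpow_le_rpow_of_exponent_ge (by positivity) hq (by linarith)
            _ = _ := by
                rw [Real.div_rpow hJ.le hm0.le, div_eq_mul_inv, ← Real.rpow_neg hm0.le,
                  mul_left_comm, ← Real.rpow_add hm0]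
                congr 2; ring
        have h4 := mul_rpow_neg_sub_one_le_sub hm1 hs0.le hs1
        have h5 : J ^ (p + 1 + s) * (t + 1) ^ (-s - 1)
            ≤ 2 / s * J ^ (p + 1 + s) * ((t + 1) ^ (-s) - (t + 1 + 1) ^ (-s)) := by
          calc _ = 2 / s * J ^ (p + 1 + s) * (s / 2 * (t + 1) ^ (-s - 1)) := by field_simp
            _ ≤ _ := by gcongr
        rw [e1, e4]
        have h6 := mul_le_mul_of_nonneg_left h1
          (by positivity : 0 ≤ 1 / r * J ^ (p + 1 - r))
        have h7 : 2 / s * J ^ (p + 1 + s) * (J ^ (-s) - (t + 1 + 1) ^ (-s))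
            = 2 / s * J ^ (p + 1 + s) * (J ^ (-s) - (t + 1) ^ (-s))
              + 2 / s * J ^ (p + 1 + s) * ((t + 1) ^ (-s) - (t + 1 + 1) ^ (-s)) := by ring
        linarith
  refine key.trans ?_
  have h1 : (min (m : ℝ) J) ^ r ≤ J ^ r :=
    Real.rpow_le_rpow (le_min (Nat.cast_nonneg m) hJ.le) (min_le_right _ _) hr0.le
  have h2 : J ^ (-s) - (max ((m : ℝ) + 1) J) ^ (-s) ≤ J ^ (-s) := by
    have : 0 ≤ (max ((m : ℝ) + 1) J) ^ (-s) := Real.rpow_nonneg (le_max_of_le_right hJ.le) _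
    linarith
  calc _ ≤ 1 / r * J ^ (p + 1 - r) * J ^ r + 2 / s * J ^ (p + 1 + s) * J ^ (-s) := by
        gcongr
    _ = 1 / r * (J ^ (p + 1 - r) * J ^ r) + 2 / s * (J ^ (p + 1 + s) * J ^ (-s)) := by ring
    _ = _ := by
        rw [← Real.rpow_add hJ, ← Real.rpow_add hJ]
        ring_nf

/-! ### Two-point and hypercube lower bounds for Gaussian observations -/

theorem measurable_lintegral_update {n : ℕ} (ν : Fin n → Measure ℝ)
    [∀ i, IsProbabilityMeasure (ν i)] (j : Fin n) {f : (Fin n → ℝ) → ℝ≥0∞} (hf : Measurable f) :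
    Measurable fun w => ∫⁻ t, f (Function.update w j t) ∂ν j := by
  have hs : (∫⋯∫⁻_{j}, f ∂ν) = fun w => ∫⁻ t, f (Function.update w j t) ∂ν j := by
    funext w; rw [lmarginal_singleton]
  rw [← hs]
  exact hf.lmarginal ν

/-- For a product of probability measures, resampling one coordinate does not change an
integral. -/
theorem lintegral_pi_update {n : ℕ} (ν : Fin n → Measure ℝ) [∀ i, IsProbabilityMeasure (ν i)]
    (j : Fin n) {f : (Fin n → ℝ) → ℝ≥0∞} (hf : Measurable f) :
    ∫⁻ w, f w ∂Measure.pi ν = ∫⁻ w, ∫⁻ t, f (Function.update w j t) ∂ν j ∂Measure.pi ν := by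
  refine lintegral_eq_of_lmarginal_eq {j} hf (measurable_lintegral_update ν j hf) ?_
  funext w
  rw [lmarginal_singleton, lmarginal_singleton]
  simp

/-- Le Cam's two-point bound: two values `± d` cannot be told apart from one Gaussian observation
whose means `± s` differ by at most two standard deviations. -/
theorem two_point_lower_bound {σ s d : ℝ} (hσ : 0 < σ) (hs : |s| ≤ σ) {g : ℝ → ℝ}
    (hg : Measurable g) :
    ENNReal.ofReal (4 * (√(2 * Real.pi))⁻¹ * Real.exp (-2) * d ^ 2) ≤
      ∫⁻ t, ENNReal.ofReal ((g (s + t) - d) ^ 2) ∂gaussianReal 0 (Real.toNNReal (σ ^ 2)) +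
      ∫⁻ t, ENNReal.ofReal ((g (-s + t) + d) ^ 2) ∂gaussianReal 0 (Real.toNNReal (σ ^ 2)) := by
  set v := Real.toNNReal (σ ^ 2) with hv
  have hvσ : (v : ℝ) = σ ^ 2 := Real.coe_toNNReal _ (by positivity)
  have hv0 : v ≠ 0 := by
    intro h
    rw [h] at hvσ
    have : 0 < σ ^ 2 := by positivity
    exact this.ne hvσ
  -- on `[-σ, σ]` both densities are at least `κ`
  set κ := (√(2 * Real.pi))⁻¹ * Real.exp (-2) / σ with hκ
  have hκ0 : 0 ≤ κ := by positivity
  have hpdf : ∀ s' : ℝ, |s'| ≤ σ → ∀ x ∈ Set.Icc (-σ) σ,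
      ENNReal.ofReal κ ≤ gaussianPDF s' v x := by
    intro s' hs' x hx
    rw [gaussianPDF, gaussianPDFReal]
    apply ENNReal.ofReal_le_ofReal
    rw [hvσ, Real.sqrt_mul (by positivity), Real.sqrt_sq hσ.le, mul_inv, hκ, mul_div_right_comm,
      div_eq_mul_inv]
    gcongr
    rw [neg_div, neg_le_neg_iff, div_le_iff₀ (by positivity)]
    have h1 := abs_le.1 hs'
    nlinarith [hx.1, hx.2]
  have hshift : ∀ (s' : ℝ) (F : ℝ → ℝ≥0∞), |s'| ≤ σ → Measurable F →
      ENNReal.ofReal κ * ∫⁻ x in Set.Icc (-σ) σ, F x ≤ ∫⁻ t, F (s' + t) ∂gaussianReal 0 v := by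
    intro s' F hs' hF
    have h1 : ∫⁻ t, F (s' + t) ∂gaussianReal 0 v = ∫⁻ x, F x ∂gaussianReal s' v := by
      have := gaussianReal_map_const_add (μ := 0) (v := v) s'
      rw [zero_add] at this
      rw [← this, lintegral_map hF (measurable_const_add s')]
    rw [h1, gaussianReal_of_var_ne_zero _ hv0,
      lintegral_withDensity_eq_lintegral_mul _ (measurable_gaussianPDF _ _) hF,
      ← lintegral_const_mul _ hF]
    refine le_trans ?_ (setLIntegral_le_lintegral (Set.Icc (-σ) σ) _)
    refine setLIntegral_mono' measurableSet_Icc fun x hx => ?_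
    simp only [Pi.mul_apply]
    gcongr
    exact hpdf s' hs' x hx
  have hF1 : Measurable fun x => ENNReal.ofReal ((g x - d) ^ 2) := by fun_prop
  have hF2 : Measurable fun x => ENNReal.ofReal ((g x + d) ^ 2) := by fun_prop
  refine le_trans ?_ (add_le_add (hshift s _ hs hF1) (hshift (-s) _ (by rwa [abs_neg]) hF2))
  rw [← mul_add, ← lintegral_add_left hF1]
  have hlow : ENNReal.ofReal (2 * d ^ 2) * ENNReal.ofReal (2 * σ) ≤
      ∫⁻ x in Set.Icc (-σ) σ, (ENNReal.ofReal ((g x - d) ^ 2) + ENNReal.ofReal ((g x + d) ^ 2)) := by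
    have hvol : volume (Set.Icc (-σ) σ) = ENNReal.ofReal (2 * σ) := by
      rw [Real.volume_Icc]; ring_nf
    rw [← hvol, ← setLIntegral_const]
    refine lintegral_mono fun x => ?_
    rw [← ENNReal.ofReal_add (by positivity) (by positivity)]
    apply ENNReal.ofReal_le_ofReal
    nlinarith [sq_nonneg (g x)]
  refine le_trans (le_of_eq ?_) (mul_le_mul_right hlow _)
  rw [← ENNReal.ofReal_mul (by positivity), ← ENNReal.ofReal_mul hκ0, hκ]
  congr 1
  field_simp
  ring

/-- Assouad's bound. The signal runs through the sign vectors `τ`, coordinate `i` of the data has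
mean `τ i * s i` with `|s i| ≤ σ`, and `τ j * d j` is to be estimated. Averaging over `τ`, paired
with its flip at `j`, reduces the `j`-th error to the two-point bound in the `j`-th coordinate. -/
theorem hypercube_lower_bound {n : ℕ} {σ : ℝ} (hσ : 0 < σ) {s d : Fin n → ℝ}
    (hs : ∀ i, |s i| ≤ σ) {g : Fin n → (Fin n → ℝ) → ℝ} (hg : ∀ j, Measurable (g j)) :
    ∃ τ : Fin n → ℤˣ,
      ENNReal.ofReal (2 * (√(2 * Real.pi))⁻¹ * Real.exp (-2) * ∑ j, d j ^ 2) ≤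
        ∫⁻ w, ENNReal.ofReal
          (∑ j, (g j (fun i => ((τ i : ℤ) : ℝ) * s i + w i) - ((τ j : ℤ) : ℝ) * d j) ^ 2)
          ∂Measure.pi fun _ => gaussianReal 0 (Real.toNNReal (σ ^ 2)) := by
  set γ := gaussianReal 0 (Real.toNNReal (σ ^ 2)) with hγ
  set κ := 2 * (√(2 * Real.pi))⁻¹ * Real.exp (-2) with hκ
  have hκ0 : 0 ≤ κ := by positivity
  set F : Fin n → (Fin n → ℤˣ) → ℝ≥0∞ := fun j τ => ∫⁻ w, ENNReal.ofReal
      ((g j (fun i => ((τ i : ℤ) : ℝ) * s i + w i) - ((τ j : ℤ) : ℝ) * d j) ^ 2)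
      ∂Measure.pi fun _ => γ with hF
  have hmeas : ∀ (j : Fin n) (τ : Fin n → ℤˣ), Measurable fun w : Fin n → ℝ => ENNReal.ofReal
      ((g j (fun i => ((τ i : ℤ) : ℝ) * s i + w i) - ((τ j : ℤ) : ℝ) * d j) ^ 2) := by
    intro j τ
    have : Measurable fun w : Fin n → ℝ => g j (fun i => ((τ i : ℤ) : ℝ) * s i + w i) :=
      (hg j).comp (by fun_prop)
    fun_prop
  have hpair : ∀ (j : Fin n) (τ : Fin n → ℤˣ), ENNReal.ofReal (2 * κ * d j ^ 2) ≤
      F j τ + F j (Function.update τ j (-τ j)) := by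
    intro j τ
    have hsq : (((τ j : ℤ) : ℝ)) ^ 2 = 1 := by
      rcases Int.units_eq_one_or (τ j) with h | h <;> simp [h]
    have habs : |((τ j : ℤ) : ℝ)| = 1 := by
      rcases Int.units_eq_one_or (τ j) with h | h <;> simp [h]
    simp only [hF]
    rw [lintegral_pi_update (fun _ => γ) j (hmeas j τ),
      lintegral_pi_update (fun _ => γ) j (hmeas j _)]
    rw [← lintegral_add_left (measurable_lintegral_update (fun _ => γ) j (hmeas j τ))]
    -- fix all data coordinates but the `j`-th, the only one in which the two models differ
    have hw : ∀ w : Fin n → ℝ, ENNReal.ofReal (2 * κ * d j ^ 2) ≤ _ := fun w =>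
      (le_of_eq (by rw [mul_pow, hsq, hκ]; ring_nf)).trans (two_point_lower_bound hσ
        (s := ((τ j : ℤ) : ℝ) * s j) (d := ((τ j : ℤ) : ℝ) * d j)
        (by rw [abs_mul, habs, one_mul]; exact hs j)
        (g := fun u => g j (Function.update (fun i => ((τ i : ℤ) : ℝ) * s i + w i) j u))
        ((hg j).comp (measurable_update _)))
    refine le_trans (le_of_eq ?_) (lintegral_mono fun w => (hw w).trans (le_of_eq ?_))
    · simp
    · congr 1
      · congr with t
        congr 4
        funext i
        by_cases hi : i = j
        · subst hi; simp
        · simp [hi]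
      · congr with t
        rw [Function.update_self, Units.val_neg, Int.cast_neg, neg_mul, sub_neg_eq_add]
        congr 4
        funext i
        by_cases hi : i = j
        · subst hi; simp
        · simp [hi]
  have hflip : ∀ j : Fin n,
      ∑ τ : Fin n → ℤˣ, F j (Function.update τ j (-τ j)) = ∑ τ, F j τ := by
    intro j
    have hinv : Function.Involutive fun τ : Fin n → ℤˣ => Function.update τ j (-τ j) := by
      intro τ; simp
    exact Equiv.sum_comp hinv.toPerm (F j)
  by_contra! hcon
  have hsum : ∀ τ : Fin n → ℤˣ, ∑ j, F j τ = ∫⁻ w, ENNReal.ofReal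
          (∑ j, (g j (fun i => ((τ i : ℤ) : ℝ) * s i + w i) - ((τ j : ℤ) : ℝ) * d j) ^ 2)
          ∂Measure.pi fun _ => γ := by
    intro τ
    simp only [hF]
    rw [← lintegral_finsetSum _ fun j _ => hmeas j τ]
    congr with w
    rw [ENNReal.ofReal_sum_of_nonneg fun _ _ => sq_nonneg _]
  have hlt : ∑ τ : Fin n → ℤˣ, ∑ j, F j τ <
      ∑ _τ : Fin n → ℤˣ, ENNReal.ofReal (κ * ∑ j, d j ^ 2) := by
    refine ENNReal.sum_lt_sum_of_nonempty Finset.univ_nonempty fun τ _ => ?_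
    rw [hsum]; exact hcon τ
  refine absurd (ENNReal.add_lt_add hlt hlt) (not_lt.2 ?_)
  rw [Finset.sum_comm (f := fun τ j => F j τ)]
  nth_rewrite 2 [← Finset.sum_congr rfl fun j _ => hflip j]
  rw [← Finset.sum_add_distrib, ← Finset.sum_add_distrib,
    Finset.sum_congr rfl fun j _ => (Finset.sum_add_distrib
      (f := fun τ => F j τ) (g := fun τ => F j (Function.update τ j (-τ j)))).symm,
    Finset.sum_comm]
  refine Finset.sum_le_sum fun τ _ => ?_
  refine le_trans (le_of_eq ?_) (Finset.sum_le_sum fun j _ => hpair j τ)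
  rw [← ENNReal.ofReal_add (by positivity) (by positivity),
    ← ENNReal.ofReal_sum_of_nonneg fun j _ => by positivity, ← Finset.mul_sum]
  congr 1; ring

/-! ### Penalized least squares in an RKHS -/

section Ridge

variable {X H : Type*} [NormedAddCommGroup H] [InnerProductSpace ℝ H] [RKHS ℝ H X ℝ]

/-- First-order characterization of penalized least-squares fits. The objective at `f + h` exceeds
that at `f` by a linear form in `h` plus a nonnegative quadratic form, so that `f` is a minimizer
exactly when the linear form vanishes. -/
theorem isMinOn_ridge_iff {m : ℕ} (xt : Fin m → X) {c κ : ℝ} (hc : 0 ≤ c) (hκ : 0 ≤ κ)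
    (u : Fin m → ℝ) (f : H) :
    IsMinOn (fun g : H => c * ∑ j, (u j - g (xt j)) ^ 2 + κ * ‖g‖ ^ 2) Set.univ f ↔
      ∀ h : H, κ * inner ℝ f h = c * ∑ j, (u j - f (xt j)) * h (xt j) := by
  have hexp : ∀ h : H, c * ∑ j, (u j - (f + h) (xt j)) ^ 2 + κ * ‖f + h‖ ^ 2 =
      c * ∑ j, (u j - f (xt j)) ^ 2 + κ * ‖f‖ ^ 2
        + 2 * (κ * inner ℝ f h - c * ∑ j, (u j - f (xt j)) * h (xt j))
        + (κ * ‖h‖ ^ 2 + c * ∑ j, h (xt j) ^ 2) := by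
    intro h
    have h1 : ∑ j, (u j - (f + h) (xt j)) ^ 2 = ∑ j, (u j - f (xt j)) ^ 2
        - 2 * ∑ j, (u j - f (xt j)) * h (xt j) + ∑ j, h (xt j) ^ 2 := by
      rw [Finset.mul_sum, ← Finset.sum_sub_distrib, ← Finset.sum_add_distrib]
      refine Finset.sum_congr rfl fun j _ => ?_
      rw [RKHS.coe_add, Pi.add_apply]
      ring
    rw [h1, norm_add_sq_real]
    ring
  rw [isMinOn_iff]
  constructor
  · intro hmin h
    set L := κ * inner ℝ f h - c * ∑ j, (u j - f (xt j)) * h (xt j) with hL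
    set Q := κ * ‖h‖ ^ 2 + c * ∑ j, h (xt j) ^ 2 with hQ
    have hQ0 : 0 ≤ Q := by
      have : 0 ≤ ∑ j, h (xt j) ^ 2 := Finset.sum_nonneg fun _ _ => sq_nonneg _
      positivity
    have hquad : ∀ t : ℝ, 0 ≤ 2 * (t * L) + t ^ 2 * Q := by
      intro t
      have h1 := hmin (f + t • h) (Set.mem_univ _)
      rw [hexp (t • h)] at h1
      have h2 : κ * inner ℝ f (t • h) - c * ∑ j, (u j - f (xt j)) * (t • h) (xt j) = t * L := by
        rw [hL, inner_smul_right, mul_sub, Finset.mul_sum, Finset.mul_sum, Finset.mul_sum]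
        congr 1
        · ring
        · refine Finset.sum_congr rfl fun j _ => ?_
          rw [RKHS.coe_smul, Pi.smul_apply, smul_eq_mul]; ring
      have h3 : κ * ‖t • h‖ ^ 2 + c * ∑ j, (t • h) (xt j) ^ 2 = t ^ 2 * Q := by
        rw [hQ, norm_smul, mul_add, mul_pow, Real.norm_eq_abs, sq_abs, Finset.mul_sum,
          Finset.mul_sum, Finset.mul_sum]
        congr 1
        · ring
        · refine Finset.sum_congr rfl fun j _ => ?_
          rw [RKHS.coe_smul, Pi.smul_apply, smul_eq_mul]; ring
      rw [h2, h3] at h1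
      linarith
    -- `Q` may vanish; `Q + 1` does not, and this step still makes the value negative if `L ≠ 0`
    have h4 := hquad (-L / (Q + 1))
    have h5 : 2 * (-L / (Q + 1) * L) + (-L / (Q + 1)) ^ 2 * Q
        = -(L ^ 2 * (Q + 2)) / (Q + 1) ^ 2 := by
      field_simp; ring
    rw [h5, le_div_iff₀ (by positivity), zero_mul] at h4
    have h6 : L ^ 2 ≤ 0 := by nlinarith [sq_nonneg L, mul_nonneg (sq_nonneg L) hQ0]
    have h7 : L = 0 := pow_eq_zero_iff two_ne_zero |>.1 (le_antisymm h6 (sq_nonneg L))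
    linarith
  · intro hnorm g _
    have h1 := hexp (g - f)
    rw [add_sub_cancel, hnorm (g - f), sub_self] at h1
    rw [h1]
    have : 0 ≤ ∑ j, (g - f) (xt j) ^ 2 := Finset.sum_nonneg fun _ _ => sq_nonneg _
    have : 0 ≤ κ * ‖g - f‖ ^ 2 + c * ∑ j, (g - f) (xt j) ^ 2 := by positivity
    linarith

end Ridge

/-! ### Diagonal designs -/

section Diagonal

variable {X H : Type*} [NormedAddCommGroup H] [InnerProductSpace ℝ H] [RKHS ℝ H X ℝ]

/-- Source and target covariates are diagonal in the orthonormal basis `e`: evaluation at `x i`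
reads off the `i`-th coordinate with weight `p i`, and evaluation at `xt j` the `j`-th coordinate
with weight `q j`. There are as many source points as dimensions, and at most as many target
points. The weights are indexed by `ℕ` so that one index serves both samples. -/
structure IsDiagonalDesign {n m : ℕ} (hmn : m ≤ n) (e : OrthonormalBasis (Fin n) ℝ H)
    (x : Fin n → X) (xt : Fin m → X) (p q : ℕ → ℝ) : Prop where
  source : ∀ (f : H) (i : Fin n), f (x i) = p i * inner ℝ (e i) f
  target : ∀ (f : H) (j : Fin m), f (xt j) = q j * inner ℝ (e (Fin.castLE hmn j)) f

theorem sum_castLE {n m : ℕ} (hmn : m ≤ n) (F : Fin n → ℝ) :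
    ∑ j : Fin m, F (Fin.castLE hmn j) = ∑ i : Fin n, if (i : ℕ) < m then F i else 0 := by
  rw [← Finset.sum_filter]
  refine Finset.sum_bij (fun j _ => Fin.castLE hmn j) ?_ ?_ ?_ ?_
  · intro j _; simp
  · intro j _ j' _ h; exact Fin.castLE_injective hmn h
  · intro i hi
    exact ⟨⟨i, (Finset.mem_filter.1 hi).2⟩, Finset.mem_univ _, by ext; simp⟩
  · intro j _; rfl

namespace IsDiagonalDesign

variable {n m : ℕ} {hmn : m ≤ n} {e : OrthonormalBasis (Fin n) ℝ H} {x : Fin n → X}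
  {xt : Fin m → X} {p q : ℕ → ℝ}

section KernelMatrices

variable [CompleteSpace H]

theorem kerFun_source (D : IsDiagonalDesign hmn e x xt p q) (i : Fin n) :
    RKHS.kerFun H (x i) (1 : ℝ) = p i • e i := by
  refine ext_inner_right ℝ fun f => ?_
  rw [RKHS.kerFun_inner, D.source, inner_smul_left]
  simp

theorem kerFun_target (D : IsDiagonalDesign hmn e x xt p q) (j : Fin m) :
    RKHS.kerFun H (xt j) (1 : ℝ) = q j • e (Fin.castLE hmn j) := by
  refine ext_inner_right ℝ fun f => ?_
  rw [RKHS.kerFun_inner, D.target, inner_smul_left]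
  simp

theorem kernelMatrix_source (D : IsDiagonalDesign hmn e x xt p q) :
    kernelMatrix H x x = Matrix.diagonal fun i : Fin n => p i ^ 2 := by
  ext i i'
  rw [kernelMatrix, Matrix.of_apply, kernelFn, ← RKHS.kerFun_apply, D.kerFun_source, D.source,
    inner_smul_right, Matrix.diagonal_apply, orthonormal_iff_ite.1 e.orthonormal]
  split_ifs with h
  · subst h; ring
  · ring

theorem kernelMatrix_target (D : IsDiagonalDesign hmn e x xt p q) :
    kernelMatrix H xt xt = Matrix.diagonal fun j : Fin m => q j ^ 2 := by
  ext j j'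
  rw [kernelMatrix, Matrix.of_apply, kernelFn, ← RKHS.kerFun_apply, D.kerFun_target, D.target,
    inner_smul_right, Matrix.diagonal_apply, orthonormal_iff_ite.1 e.orthonormal]
  simp only [(Fin.castLE_injective hmn).eq_iff]
  split_ifs with h
  · subst h; ring
  · ring

theorem kernelMatrix_target_source (D : IsDiagonalDesign hmn e x xt p q) :
    kernelMatrix H xt x =
      Matrix.of fun j i => if Fin.castLE hmn j = i then q j * p i else 0 := by
  ext j i
  rw [kernelMatrix, Matrix.of_apply, kernelFn, ← RKHS.kerFun_apply, D.kerFun_source, D.target,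
    inner_smul_right, Matrix.of_apply, orthonormal_iff_ite.1 e.orthonormal]
  split_ifs with h <;> ring

theorem ridgeTeacher_mulVec (D : IsDiagonalDesign hmn e x xt p q) {lam : ℝ}
    (hlam : 0 < lam * n) (v : Fin n → ℝ) (j : Fin m) :
    (ridgeTeacher H x xt lam *ᵥ v) j =
      q j * p j / (p j ^ 2 + lam * n) * v (Fin.castLE hmn j) := by
  have hinv : (kernelMatrix H x x + (lam * (n : ℝ)) • (1 : Matrix (Fin n) (Fin n) ℝ))⁻¹ =
      Matrix.diagonal fun i : Fin n => (p i ^ 2 + lam * n)⁻¹ := by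
    apply Matrix.inv_eq_right_inv
    rw [D.kernelMatrix_source, Matrix.smul_one_eq_diagonal, Matrix.diagonal_add,
      Matrix.diagonal_mul_diagonal, ← Matrix.diagonal_one]
    congr 1
    funext i
    have : 0 < p i ^ 2 + lam * n := by positivity
    exact mul_inv_cancel₀ this.ne'
  rw [ridgeTeacher, hinv, D.kernelMatrix_target_source]
  simp only [Matrix.mulVec, dotProduct, Matrix.mul_diagonal, Matrix.of_apply, ite_mul, zero_mul,
    Finset.sum_ite_eq, Finset.mem_univ, if_true]
  simp [div_eq_mul_inv]

end KernelMatrices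

/-- In a diagonal design the normal equations of a penalized least-squares fit decouple over the
coordinates. -/
theorem isMinOn_ridge_iff_coord (D : IsDiagonalDesign hmn e x xt p q) {c κ : ℝ} (hc : 0 ≤ c)
    (hκ : 0 ≤ κ) (U : Fin n → ℝ) (f : H) :
    IsMinOn (fun g : H => c * ∑ j, (U (Fin.castLE hmn j) - g (xt j)) ^ 2 + κ * ‖g‖ ^ 2)
        Set.univ f ↔
      ∀ i : Fin n, κ * inner ℝ (e i) f =
        if (i : ℕ) < m then c * ((U i - q i * inner ℝ (e i) f) * q i) else 0 := by
  rw [isMinOn_ridge_iff xt hc hκ (fun j => U (Fin.castLE hmn j))]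
  have hsum : ∀ h : H, ∑ j, (U (Fin.castLE hmn j) - f (xt j)) * h (xt j) =
      ∑ i : Fin n, if (i : ℕ) < m then
        (U i - q i * inner ℝ (e i) f) * q i * inner ℝ (e i) h else 0 := by
    intro h
    rw [← sum_castLE hmn fun i => (U i - q i * inner ℝ (e i) f) * q i * inner ℝ (e i) h]
    refine Finset.sum_congr rfl fun j _ => ?_
    rw [D.target, D.target]
    simp only [Fin.val_castLE]
    ring
  constructor
  · intro h i
    have h1 := h (e i)
    rw [hsum, real_inner_comm] at h1
    simp only [orthonormal_iff_ite.1 e.orthonormal] at h1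
    rw [h1, Finset.sum_eq_single i]
    · simp only [↓reduceIte, mul_one, mul_ite, mul_zero]
    · intro i' _ hne; simp [hne]
    · intro hi; exact absurd (Finset.mem_univ i) hi
  · intro h g
    rw [hsum, ← OrthonormalBasis.sum_inner_mul_inner e f g, Finset.mul_sum, Finset.mul_sum]
    refine Finset.sum_congr rfl fun i _ => ?_
    rw [real_inner_comm, ← mul_assoc, h i]
    split_ifs <;> ring

variable [CompleteSpace H]

/-- In a diagonal design, the RaT estimate multiplies each of the first `m` responses by a
shrinkage weight, which does not depend on the stepsize, and sets the other coordinates to `0`. -/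
theorem isRaTEstimate_iff (D : IsDiagonalDesign hmn e x xt p q) {lam γ η : ℝ}
    (hlam : 0 < lam * n) (hγ : 0 < γ * m) (hη : 0 < η) (y : Fin n → ℝ) (f : H) :
    IsRaTEstimate (ridgeTeacher H x xt lam) x xt γ η y f ↔
      ∀ i : Fin n, inner ℝ (e i) f =
        (if (i : ℕ) < m then q i * p i / (p i ^ 2 + lam * n) * q i /
          (γ * m + q i * p i / (p i ^ 2 + lam * n) * q i * p i) else 0) * y i := by
  set t : ℕ → ℝ := fun i => q i * p i / (p i ^ 2 + lam * n) with ht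
  have hu : ∀ j, f (xt j) - η * gradHat (ridgeTeacher H x xt lam) x y f j =
      (fun i : Fin n => q i * inner ℝ (e i) f
        - η * (t i * (p i * inner ℝ (e i) f - y i))) (Fin.castLE hmn j) := by
    intro j
    rw [gradHat, D.ridgeTeacher_mulVec hlam, D.target, D.source]
    simp [ht]
  simp only [IsRaTEstimate, IsProxUpdate, hu]
  refine (D.isMinOn_ridge_iff_coord (by positivity) (by positivity) (fun i : Fin n =>
    q i * inner ℝ (e i) f - η * (t i * (p i * inner ℝ (e i) f - y i))) f).trans ?_
  refine forall_congr' fun i => ?_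
  have htq : 0 ≤ t i * q i * p i := by
    have : t i * q i * p i = (q i * p i) ^ 2 / (p i ^ 2 + lam * n) := by rw [ht]; ring
    rw [this]; positivity
  have hpos : 0 < γ * m + t i * q i * p i := by positivity
  have hti : q i * p i / (p i ^ 2 + lam * n) = t i := rfl
  simp only [hti]
  split_ifs with hi
  · rw [div_mul_eq_mul_div (t i * q i), eq_div_iff hpos.ne']
    have : 1 / (2 * η) * ((q i * inner ℝ (e i) f - η * (t i * (p i * inner ℝ (e i) f - y i))
        - q i * inner ℝ (e i) f) * q i)
        = -(t i * (p i * inner ℝ (e i) f - y i)) * q i / 2 := by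
      field_simp; ring
    rw [this]
    exact ⟨fun h => by linear_combination 2 * h, fun h => by linear_combination h / 2⟩
  · rw [zero_mul, mul_eq_zero]
    have : γ * m / 2 ≠ 0 := by positivity
    simp [this]

/-- In a diagonal design, the SM estimate multiplies each of the first `m` responses by a
shrinkage weight and sets the other coordinates to `0`. -/
theorem isSMEstimate_iff (D : IsDiagonalDesign hmn e x xt p q) {lam γ : ℝ}
    (hlam : 0 < lam * n) (hγ : 0 < γ * m) (y : Fin n → ℝ) (f : H) :
    IsSMEstimate (ridgeTeacher H x xt lam) xt γ y f ↔
      ∀ i : Fin n, inner ℝ (e i) f =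
        (if (i : ℕ) < m then q i * p i / (p i ^ 2 + lam * n) * q i / (γ * m + q i ^ 2) else 0)
          * y i := by
  set t : ℕ → ℝ := fun i => q i * p i / (p i ^ 2 + lam * n) with ht
  have hu : (fun g : H => ∑ j, 1 / 2 * (g (xt j) - (ridgeTeacher H x xt lam *ᵥ y) j) ^ 2
      + γ * (m : ℝ) / 2 * ‖g‖ ^ 2) = fun g : H => 1 / 2 * ∑ j,
        ((fun i : Fin n => t i * y i) (Fin.castLE hmn j) - g (xt j)) ^ 2
          + γ * (m : ℝ) / 2 * ‖g‖ ^ 2 := by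
    funext g
    rw [Finset.mul_sum]
    congr 1
    refine Finset.sum_congr rfl fun j _ => ?_
    rw [D.ridgeTeacher_mulVec hlam]
    simp only [ht, Fin.val_castLE]
    ring
  rw [IsSMEstimate, hu]
  refine (D.isMinOn_ridge_iff_coord (by positivity) (by positivity) (fun i : Fin n =>
    t i * y i) f).trans ?_
  refine forall_congr' fun i => ?_
  have hpos : 0 < γ * m + q i ^ 2 := by positivity
  have hti : q i * p i / (p i ^ 2 + lam * n) = t i := rfl
  simp only [hti]
  split_ifs with hi
  · rw [div_mul_eq_mul_div (t i * q i), eq_div_iff hpos.ne']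
    exact ⟨fun h => by linear_combination 2 * h, fun h => by linear_combination h / 2⟩
  · rw [zero_mul, mul_eq_zero]
    have : γ * m / 2 ≠ 0 := by positivity
    simp [this]

end IsDiagonalDesign

theorem existsUnique_inner_eq {n : ℕ} (e : OrthonormalBasis (Fin n) ℝ H) (c : Fin n → ℝ) :
    ∃! f : H, ∀ i, inner ℝ (e i) f = c i := by
  refine ⟨e.repr.symm (WithLp.toLp 2 c), fun i => ?_, fun f hf => ?_⟩
  · simp [← e.repr_apply_apply]
  · rw [LinearIsometryEquiv.eq_symm_apply]
    ext i
    rw [e.repr_apply_apply, hf]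

end Diagonal

/-! ### Mean-squared error of coordinatewise linear estimators -/

theorem IsNoiseLaw.integrable_affine_sq {ν : Measure ℝ} {σ : ℝ} (hν : IsNoiseLaw ν σ) (a b : ℝ) :
    Integrable (fun t => (a + b * t) ^ 2) ν := by
  obtain ⟨_, h2, -, -⟩ := hν
  exact ((memLp_const a).add (h2.const_mul b)).integrable_sq

theorem IsNoiseLaw.integral_affine_sq {ν : Measure ℝ} {σ : ℝ} (hν : IsNoiseLaw ν σ) (a b : ℝ) :
    ∫ t, (a + b * t) ^ 2 ∂ν = a ^ 2 + b ^ 2 * σ ^ 2 := by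
  obtain ⟨_, h2, h0, hvar⟩ := hν
  have hsq : ∫ t, t ^ 2 ∂ν = σ ^ 2 := by
    have := variance_eq_sub h2
    simp only [id_eq, Pi.pow_apply, h0, hvar] at this
    linarith
  have i1 : Integrable (fun t : ℝ => t) ν := h2.integrable (by norm_num)
  have i2 : Integrable (fun t : ℝ => t ^ 2) ν := h2.integrable_sq
  have : ∀ t : ℝ, (a + b * t) ^ 2 = (a ^ 2 + 2 * a * b * t) + b ^ 2 * t ^ 2 := fun t => by ring
  simp_rw [this]
  have i3 : Integrable (fun t : ℝ => a ^ 2 + 2 * a * b * t) ν :=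
    (integrable_const _).add (i1.const_mul _)
  rw [integral_add i3 (i2.const_mul _), integral_add (integrable_const _) (i1.const_mul _),
    integral_const_mul, integral_const_mul, h0, hsq]
  simp

section Diagonal

variable {X H : Type*} [NormedAddCommGroup H] [InnerProductSpace ℝ H] [RKHS ℝ H X ℝ]
  {n m : ℕ} {hmn : m ≤ n} {e : OrthonormalBasis (Fin n) ℝ H} {x : Fin n → X}
  {xt : Fin m → X} {p q : ℕ → ℝ}

/-- Exact bias-variance decomposition: in a diagonal design, the estimator that multiplies the
`i`-th response by `ρ i` has squared bias `(ρ p - 1)² θ²` and variance `ρ² σ²` in each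
coordinate. -/
theorem IsDiagonalDesign.mse_eq (D : IsDiagonalDesign hmn e x xt p q) {ν : Fin n → Measure ℝ}
    {σ : ℝ} (hν : ∀ i, IsNoiseLaw (ν i) σ) {ρ : ℕ → ℝ} {fhat : (Fin n → ℝ) → H}
    (hf : ∀ y (i : Fin n), inner ℝ (e i) (fhat y) = ρ i * y i) (fstar : H) :
    mse ν x xt (fun y => fhat y) fstar =
      ENNReal.ofReal (1 / (m : ℝ) * ∑ j : Fin m, q j ^ 2 *
        ((ρ j * p j - 1) ^ 2 * inner ℝ (e (Fin.castLE hmn j)) fstar ^ 2 + ρ j ^ 2 * σ ^ 2)) := by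
  have : ∀ i, IsProbabilityMeasure (ν i) := fun i => (hν i).1
  have hpt : ∀ (w : Fin n → ℝ) (j : Fin m),
      (fhat (fun i => fstar (x i) + w i) (xt j) - fstar (xt j)) ^ 2 =
        q j ^ 2 * ((ρ j * p j - 1) * inner ℝ (e (Fin.castLE hmn j)) fstar
          + ρ j * w (Fin.castLE hmn j)) ^ 2 := by
    intro w j
    rw [D.target, D.target, hf, D.source]
    simp only [Fin.val_castLE]
    ring
  have hint : ∀ j : Fin m, Integrable (fun w : Fin n → ℝ =>
      ((ρ j * p j - 1) * inner ℝ (e (Fin.castLE hmn j)) fstar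
          + ρ j * w (Fin.castLE hmn j)) ^ 2) (Measure.pi ν) := fun j =>
    integrable_comp_eval (X := fun _ => ℝ) (μ := ν) (i := Fin.castLE hmn j)
      (f := fun t : ℝ => ((ρ j * p j - 1) * inner ℝ (e (Fin.castLE hmn j)) fstar + ρ j * t) ^ 2)
      ((hν (Fin.castLE hmn j)).integrable_affine_sq
        ((ρ j * p j - 1) * inner ℝ (e (Fin.castLE hmn j)) fstar) (ρ j))
  rw [mse]
  simp_rw [hpt]
  rw [← ofReal_integral_eq_lintegral_ofReal]
  · rw [integral_const_mul, integral_finsetSum _ fun j _ => (hint j).const_mul _]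
    congr 2
    refine Finset.sum_congr rfl fun j _ => ?_
    rw [integral_const_mul, integral_comp_eval (X := fun _ => ℝ) (μ := ν) (i := Fin.castLE hmn j)
      (f := fun t : ℝ => ((ρ j * p j - 1) * inner ℝ (e (Fin.castLE hmn j)) fstar + ρ j * t) ^ 2)
      (Continuous.aestronglyMeasurable (by fun_prop)),
      (hν _).integral_affine_sq]
    ring
  · exact (integrable_finsetSum _ fun j _ => (hint j).const_mul _).const_mul _
  · refine Filter.Eventually.of_forall fun w => ?_
    positivity

end Diagonal

/-! ### The shrinkage factors of RaT for polynomially decaying weights -/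

/-- The factor by which RaT shrinks the coordinate at position `t ≥ 1`, when source and target
eigenvalues are `t ^ (-2 α)` and `t ^ (-2 β)`. -/
noncomputable def ratShrinkage (α β lam γ t : ℝ) : ℝ :=
  t ^ (-2 * (α + β)) / (t ^ (-2 * α) + lam) /
    (γ + t ^ (-2 * (α + β)) / (t ^ (-2 * α) + lam))

section Shrinkage

variable {α β lam γ J t : ℝ}

theorem ratShrinkage_nonneg (hlam : 0 < lam) (hγ : 0 < γ) (ht : 0 < t) :
    0 ≤ ratShrinkage α β lam γ t := by
  unfold ratShrinkage; positivity

theorem ratShrinkage_le_one (hlam : 0 < lam) (hγ : 0 < γ) (ht : 0 < t) :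
    ratShrinkage α β lam γ t ≤ 1 := by
  unfold ratShrinkage
  exact div_le_one_of_le₀ (by linarith) (by positivity)

theorem one_sub_ratShrinkage (hlam : 0 < lam) (hγ : 0 < γ) (ht : 0 < t) :
    1 - ratShrinkage α β lam γ t =
      γ / (γ + t ^ (-2 * (α + β)) / (t ^ (-2 * α) + lam)) := by
  unfold ratShrinkage
  have : 0 < γ + t ^ (-2 * (α + β)) / (t ^ (-2 * α) + lam) := by positivity
  rw [eq_div_iff this.ne', sub_mul, div_mul_cancel₀ _ this.ne']
  ring

/-- Beyond the cutoff `J` the RaT factors decay polynomially; the bias `lam` of the teacher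
cancels against the `1 / lam` in the choice of the penalty. -/
theorem ratShrinkage_le (hlam : 0 < lam) (hJ : 0 < J) (ht : 0 < t) :
    ratShrinkage α β lam (1 / lam * J ^ (-2 * (α + β))) t ≤ (J / t) ^ (2 * (α + β)) := by
  unfold ratShrinkage
  have h1 : t ^ (-2 * (α + β)) / (t ^ (-2 * α) + lam) ≤ t ^ (-2 * (α + β)) / lam := by
    gcongr
    have : 0 < t ^ (-2 * α) := by positivity
    linarith
  have h2 : (J / t) ^ (2 * (α + β)) = t ^ (-2 * (α + β)) / J ^ (-2 * (α + β)) := by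
    rw [Real.div_rpow hJ.le ht.le, neg_mul, Real.rpow_neg ht.le, Real.rpow_neg hJ.le]
    field_simp
  rw [h2]
  calc _ ≤ t ^ (-2 * (α + β)) / lam / (1 / lam * J ^ (-2 * (α + β))) := by
        gcongr
        have : 0 ≤ t ^ (-2 * (α + β)) / (t ^ (-2 * α) + lam) := by positivity
        linarith
    _ = _ := by field_simp

/-- The weighted squared bias of RaT. For `t ≥ J` the weight alone is small enough; for `t < J`
the factor is close to `1`, and necessarily `J > 1`. -/
theorem sq_one_sub_ratShrinkage_le (hα : 0 < α) (hβ : 0 < β) (hlam : 0 < lam) (hJ : 0 < J)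
    (ht : 1 ≤ t) :
    t ^ (-2 * β) * (ratShrinkage α β lam (1 / lam * J ^ (-2 * (α + β))) t - 1) ^ 2 ≤
      J ^ (-2 * β) * (1 + min 1 (J ^ (-2 * α)) / lam) := by
  have ht0 : 0 < t := by linarith
  set γ := 1 / lam * J ^ (-2 * (α + β)) with hγdef
  have hγ : 0 < γ := by positivity
  set s := ratShrinkage α β lam γ t with hs
  have hs0 : 0 ≤ s := ratShrinkage_nonneg hlam hγ ht0
  have hs1 : s ≤ 1 := ratShrinkage_le_one hlam hγ ht0
  have hsq : (s - 1) ^ 2 ≤ 1 - s := by nlinarith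
  have hmin : 0 ≤ min 1 (J ^ (-2 * α)) / lam :=
    div_nonneg (le_min zero_le_one (by positivity)) hlam.le
  rcases le_or_gt J t with h | h
  · calc t ^ (-2 * β) * (s - 1) ^ 2 ≤ J ^ (-2 * β) * 1 := by
          have h1 := Real.rpow_le_rpow_of_nonpos hJ h (by linarith : -2 * β ≤ 0)
          have h2 : (s - 1) ^ 2 ≤ 1 := by linarith
          exact mul_le_mul h1 h2 (sq_nonneg _) (by positivity)
      _ ≤ _ := by gcongr; linarith
  · have hJ1 : J ^ (-2 * α) ≤ 1 :=
      Real.rpow_le_one_of_one_le_of_nonpos (by linarith) (by linarith)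
    rw [min_eq_right hJ1]
    have h1 : 1 - s ≤ γ * (t ^ (-2 * α) + lam) * t ^ (2 * (α + β)) := by
      rw [hs, one_sub_ratShrinkage hlam hγ ht0]
      have e1 : γ / (t ^ (-2 * (α + β)) / (t ^ (-2 * α) + lam)) =
          γ * (t ^ (-2 * α) + lam) * t ^ (2 * (α + β)) := by
        rw [neg_mul 2 (α + β), Real.rpow_neg ht0.le]; field_simp
      rw [← e1]
      gcongr
      linarith
    have e2 : t ^ (-2 * β) * (γ * (t ^ (-2 * α) + lam) * t ^ (2 * (α + β))) =
        J ^ (-2 * β) * (J ^ (-2 * α) * t ^ (2 * α) + J ^ (-2 * α) / lam) := by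
      have a1 : t ^ (2 * (α + β)) = t ^ (2 * α) * t ^ (2 * β) := by
        rw [← Real.rpow_add ht0]; ring_nf
      have a2 : J ^ (-2 * (α + β)) = J ^ (-2 * α) * J ^ (-2 * β) := by
        rw [← Real.rpow_add hJ]; ring_nf
      rw [hγdef, a1, a2, neg_mul 2 β, neg_mul 2 α, Real.rpow_neg ht0.le, Real.rpow_neg ht0.le]
      field_simp
      ring
    have h3 : J ^ (-2 * α) * t ^ (2 * α) ≤ 1 := by
      calc J ^ (-2 * α) * t ^ (2 * α) ≤ J ^ (-2 * α) * J ^ (2 * α) := by gcongr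
        _ = 1 := by rw [← Real.rpow_add hJ]; simp
    calc t ^ (-2 * β) * (s - 1) ^ 2
        ≤ t ^ (-2 * β) * (γ * (t ^ (-2 * α) + lam) * t ^ (2 * (α + β))) := by
          gcongr; linarith
      _ ≤ _ := by rw [e2]; gcongr

end Shrinkage

/-! ### Diagonal designs with polynomial eigendecay -/

/-- The weights `√n k ^ (-α)` (the index is `k - 1`), for which the normalized kernel matrix of a
diagonal design has eigenvalues `k ^ (-2 α)`. -/
noncomputable def powerWeight (n : ℕ) (α : ℝ) (k : ℕ) : ℝ := √n * ((k : ℝ) + 1) ^ (-α)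

theorem powerWeight_sq (n : ℕ) (α : ℝ) (k : ℕ) :
    powerWeight n α k ^ 2 = n * ((k : ℝ) + 1) ^ (-2 * α) := by
  have hk : (0 : ℝ) < (k : ℝ) + 1 := by positivity
  rw [powerWeight, mul_pow, Real.sq_sqrt (Nat.cast_nonneg n), ← Real.rpow_natCast,
    ← Real.rpow_mul hk.le]
  congr 2
  push_cast; ring

theorem powerWeight_pos {n : ℕ} (hn : 0 < n) (α : ℝ) (k : ℕ) : 0 < powerWeight n α k := by
  unfold powerWeight
  have : (0 : ℝ) < n := by exact_mod_cast hn
  positivity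

section Power

variable {X H : Type*} [NormedAddCommGroup H] [InnerProductSpace ℝ H] [RKHS ℝ H X ℝ]
  {n m : ℕ} {hmn : m ≤ n} {e : OrthonormalBasis (Fin n) ℝ H} {x : Fin n → X}
  {xt : Fin m → X} {α β : ℝ}

theorem IsDiagonalDesign.hasEigendecay_source [CompleteSpace H]
    (D : IsDiagonalDesign hmn e x xt (powerWeight n α) (powerWeight m β)) (hn : 0 < n)
    (hα : 0 ≤ α) : HasEigendecay ((1 / (n : ℝ)) • kernelMatrix H x x) α 1 1 := by
  have : (1 / (n : ℝ)) • kernelMatrix H x x =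
      Matrix.diagonal fun j : Fin n => ((j : ℝ) + 1) ^ (-2 * α) := by
    rw [D.kernelMatrix_source, ← Matrix.diagonal_smul]
    congr 1
    funext i
    have : (n : ℝ) ≠ 0 := by positivity
    rw [Pi.smul_apply, smul_eq_mul, powerWeight_sq]
    field_simp
  rw [this]
  exact hasEigendecay_diagonal n hα

theorem IsDiagonalDesign.hasEigendecay_target [CompleteSpace H]
    (D : IsDiagonalDesign hmn e x xt (powerWeight n α) (powerWeight m β)) (hm : 0 < m)
    (hβ : 0 ≤ β) : HasEigendecay ((1 / (m : ℝ)) • kernelMatrix H xt xt) β 1 1 := by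
  have : (1 / (m : ℝ)) • kernelMatrix H xt xt =
      Matrix.diagonal fun j : Fin m => ((j : ℝ) + 1) ^ (-2 * β) := by
    rw [D.kernelMatrix_target, ← Matrix.diagonal_smul]
    congr 1
    funext i
    have : (m : ℝ) ≠ 0 := by positivity
    rw [Pi.smul_apply, smul_eq_mul, powerWeight_sq]
    field_simp
  rw [this]
  exact hasEigendecay_diagonal m hβ

theorem sum_inner_sq_castLE_le (hmn : m ≤ n) (e : OrthonormalBasis (Fin n) ℝ H) (f : H) :
    ∑ j : Fin m, inner ℝ (e (Fin.castLE hmn j)) f ^ 2 ≤ ‖f‖ ^ 2 := by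
  rw [sum_castLE hmn fun i => inner ℝ (e i) f ^ 2, ← e.sum_sq_norm_inner_right f]
  refine Finset.sum_le_sum fun i _ => ?_
  rw [Real.norm_eq_abs, sq_abs]
  split_ifs
  · exact le_rfl
  · positivity

/-! ### Upper bound for RaT -/

/-- The error of RaT in terms of the cutoff `J`, which solves `σ² / (R² n) = J ^ (-(2 α + 1))`. The
constant `C` is that of the truncated power sum bounding the variance. -/
theorem IsDiagonalDesign.mse_rat_le [CompleteSpace H]
    (D : IsDiagonalDesign hmn e x xt (powerWeight n α) (powerWeight m β)) (hm : 0 < m)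
    (hα : 0 < α) (hβ : 0 < β) {C : ℝ}
    (hC : ∀ (J : ℝ) (m : ℕ), 0 < J → ∑ j ∈ Finset.range m, ((j : ℝ) + 1) ^ (2 * α - 2 * β) *
      min 1 ((J / ((j : ℝ) + 1)) ^ (2 * (α + β))) ≤ C * J ^ (2 * α - 2 * β + 1))
    {lam R σ J η : ℝ} (hlam : 0 < lam) (hR : 0 < R) (hJ : 0 < J) (hη : 0 < η)
    (hJσ : σ ^ 2 / n = R ^ 2 * J ^ (-(2 * α + 1)))
    {ν : Fin n → Measure ℝ} (hν : ∀ i, IsNoiseLaw (ν i) σ) {fRaT : (Fin n → ℝ) → H}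
    (hf : ∀ y, IsRaTEstimate (ridgeTeacher H x xt lam) x xt
      (1 / lam * J ^ (-2 * (α + β))) η y (fRaT y))
    {fstar : H} (hstar : ‖fstar‖ ≤ R) :
    mse ν x xt (fun y => fRaT y) fstar ≤
      ENNReal.ofReal ((1 + min 1 (J ^ (-2 * α)) / lam + C) * R ^ 2 * J ^ (-2 * β)) := by
  have hn : 0 < n := hm.trans_le hmn
  have hnR : (0 : ℝ) < n := by exact_mod_cast hn
  have hmR : (0 : ℝ) < m := by exact_mod_cast hm
  set γ := 1 / lam * J ^ (-2 * (α + β)) with hγdef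
  have hγ : 0 < γ := by positivity
  set p := powerWeight n α with hp
  set q := powerWeight m β with hq
  have hcoord := fun y => (D.isRaTEstimate_iff (by positivity) (by positivity) hη y _).1 (hf y)
  rw [D.mse_eq hν (ρ := fun i => if i < m then q i * p i / (p i ^ 2 + lam * n) * q i /
          (γ * m + q i * p i / (p i ^ 2 + lam * n) * q i * p i) else 0) hcoord]
  apply ENNReal.ofReal_le_ofReal
  have hterm : ∀ j : Fin m, (fun i : ℕ => if i < m then q i * p i / (p i ^ 2 + lam * n) * q i /
      (γ * m + q i * p i / (p i ^ 2 + lam * n) * q i * p i) else 0) j =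
      ratShrinkage α β lam γ ((j : ℝ) + 1) / p j := by
    intro j
    have hpj : 0 < p j := powerWeight_pos hn α j
    have ht : (0 : ℝ) < (j : ℝ) + 1 := by positivity
    simp only [j.2, if_true]
    have h1 : q j * p j / (p j ^ 2 + lam * n) * q j * p j =
        m * (((j : ℝ) + 1) ^ (-2 * (α + β)) / (((j : ℝ) + 1) ^ (-2 * α) + lam)) := by
      have : q j * p j / (p j ^ 2 + lam * n) * q j * p j =
        q j ^ 2 * p j ^ 2 / (p j ^ 2 + lam * n) := by ring
      rw [this, hq, hp, powerWeight_sq, powerWeight_sq, mul_add, Real.rpow_add ht]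
      have h2 : 0 < ((j : ℝ) + 1) ^ (-2 * α) + lam := by positivity
      field_simp
    rw [eq_div_iff hpj.ne', div_mul_eq_mul_div, h1, ratShrinkage]
    set A := ((j : ℝ) + 1) ^ (-2 * (α + β)) / (((j : ℝ) + 1) ^ (-2 * α) + lam) with hA
    have hA0 : 0 < A := by positivity
    have : γ * m + m * A = m * (γ + A) := by ring
    rw [this, mul_div_mul_left _ _ hmR.ne']
  have hsum : 1 / (m : ℝ) * ∑ j : Fin m, q j ^ 2 *
      (((fun i : ℕ => if i < m then q i * p i / (p i ^ 2 + lam * n) * q i /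
      (γ * m + q i * p i / (p i ^ 2 + lam * n) * q i * p i) else 0) j * p j - 1) ^ 2
        * inner ℝ (e (Fin.castLE hmn j)) fstar ^ 2 +
        ((fun i : ℕ => if i < m then q i * p i / (p i ^ 2 + lam * n) * q i /
      (γ * m + q i * p i / (p i ^ 2 + lam * n) * q i * p i) else 0) j) ^ 2 * σ ^ 2) =
      ∑ j : Fin m, (((j : ℝ) + 1) ^ (-2 * β) * (ratShrinkage α β lam γ ((j : ℝ) + 1) - 1) ^ 2
        * inner ℝ (e (Fin.castLE hmn j)) fstar ^ 2 +
        R ^ 2 * J ^ (-(2 * α + 1)) * (((j : ℝ) + 1) ^ (2 * α - 2 * β) *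
          ratShrinkage α β lam γ ((j : ℝ) + 1) ^ 2)) := by
    rw [Finset.mul_sum]
    refine Finset.sum_congr rfl fun j _ => ?_
    have hpj : 0 < p j := powerWeight_pos hn α j
    have ht : (0 : ℝ) < (j : ℝ) + 1 := by positivity
    rw [hterm, div_mul_cancel₀ _ hpj.ne', div_pow, ← hJσ, hq, hp, powerWeight_sq, powerWeight_sq]
    have h1 : ((j : ℝ) + 1) ^ (2 * α - 2 * β) =
        ((j : ℝ) + 1) ^ (-2 * β) / ((j : ℝ) + 1) ^ (-2 * α) := by
      rw [← Real.rpow_sub ht]; ring_nf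
    rw [h1]
    field_simp
  rw [hsum, Finset.sum_add_distrib]
  have hbias : ∑ j : Fin m, ((j : ℝ) + 1) ^ (-2 * β) *
      (ratShrinkage α β lam γ ((j : ℝ) + 1) - 1) ^ 2 * inner ℝ (e (Fin.castLE hmn j)) fstar ^ 2 ≤
      J ^ (-2 * β) * (1 + min 1 (J ^ (-2 * α)) / lam) * R ^ 2 := by
    have hmin : 0 ≤ min 1 (J ^ (-2 * α)) / lam :=
      div_nonneg (le_min zero_le_one (by positivity)) hlam.le
    calc _ ≤ ∑ j : Fin m, J ^ (-2 * β) * (1 + min 1 (J ^ (-2 * α)) / lam) *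
          inner ℝ (e (Fin.castLE hmn j)) fstar ^ 2 := by
          refine Finset.sum_le_sum fun j _ => ?_
          refine mul_le_mul_of_nonneg_right ?_ (sq_nonneg _)
          exact sq_one_sub_ratShrinkage_le hα hβ hlam hJ (by simp)
      _ ≤ _ := by
          rw [← Finset.mul_sum]
          refine mul_le_mul_of_nonneg_left ?_ (by positivity)
          exact (sum_inner_sq_castLE_le hmn e fstar).trans (by gcongr)
  have hvar : ∑ j : Fin m, R ^ 2 * J ^ (-(2 * α + 1)) * (((j : ℝ) + 1) ^ (2 * α - 2 * β) *
      ratShrinkage α β lam γ ((j : ℝ) + 1) ^ 2) ≤ C * R ^ 2 * J ^ (-2 * β) := by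
    rw [← Finset.mul_sum]
    calc _ ≤ R ^ 2 * J ^ (-(2 * α + 1)) * ∑ j : Fin m, ((j : ℝ) + 1) ^ (2 * α - 2 * β) *
          min 1 ((J / ((j : ℝ) + 1)) ^ (2 * (α + β))) := by
          gcongr with j
          have ht : (0 : ℝ) < (j : ℝ) + 1 := by positivity
          have h0 := ratShrinkage_nonneg (α := α) (β := β) hlam hγ ht
          have h1 := ratShrinkage_le_one (α := α) (β := β) hlam hγ ht
          have h2 := ratShrinkage_le (α := α) (β := β) hlam hJ ht
          calc ratShrinkage α β lam γ ((j : ℝ) + 1) ^ 2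
              ≤ ratShrinkage α β lam γ ((j : ℝ) + 1) := by nlinarith
            _ ≤ _ := le_min h1 h2
      _ ≤ R ^ 2 * J ^ (-(2 * α + 1)) * (C * J ^ (2 * α - 2 * β + 1)) := by
          refine mul_le_mul_of_nonneg_left ?_ (by positivity)
          rw [Fin.sum_univ_eq_sum_range (fun j : ℕ => ((j : ℝ) + 1) ^ (2 * α - 2 * β) *
            min 1 ((J / ((j : ℝ) + 1)) ^ (2 * (α + β))))]
          exact hC J m hJ
      _ = C * R ^ 2 * (J ^ (-(2 * α + 1)) * J ^ (2 * α - 2 * β + 1)) := by ring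
      _ = _ := by
          rw [← Real.rpow_add hJ]
          ring_nf
  linarith

/-! ### Lower bound for soft matching -/

/-- Soft matching cannot undo the bias of the teacher: on the leading direction, where the source
eigenvalue is `1`, every fit shrinks the signal at least by the factor `1 / (1 + lam)`. -/
theorem IsDiagonalDesign.le_iSup_iInf_mse_sm [CompleteSpace H]
    (D : IsDiagonalDesign hmn e x xt (powerWeight n α) (powerWeight m β)) (hm : 0 < m)
    {lam R σ : ℝ} (hlam : 0 < lam) (hR : 0 ≤ R)
    {ν : Fin n → Measure ℝ} (hν : ∀ i, IsNoiseLaw (ν i) σ) {fSM : ℝ → (Fin n → ℝ) → H}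
    (hf : ∀ γ : ℝ, 0 < γ → ∀ y,
      IsSMEstimate (ridgeTeacher H x xt lam) xt γ y (fSM γ y)) :
    ENNReal.ofReal ((lam / (1 + lam)) ^ 2 * R ^ 2) ≤
      ⨆ (fstar : H) (_ : ‖fstar‖ ≤ R), ⨅ (γ : ℝ) (_ : 0 < γ),
        mse ν x xt (fun y => fSM γ y) fstar := by
  have hn : 0 < n := hm.trans_le hmn
  have hnR : (0 : ℝ) < n := by exact_mod_cast hn
  have hmR : (0 : ℝ) < m := by exact_mod_cast hm
  set i₀ : Fin n := Fin.castLE hmn ⟨0, hm⟩ with hi₀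
  refine le_iSup₂_of_le (R • e i₀) ?_ (le_iInf₂ fun γ hγ => ?_)
  · rw [norm_smul, e.norm_eq_one, Real.norm_of_nonneg hR, mul_one]
  set p := powerWeight n α with hp
  set q := powerWeight m β with hq
  have hcoord := fun y => (D.isSMEstimate_iff (by positivity) (by positivity) y _).1 (hf γ hγ y)
  rw [D.mse_eq hν (ρ := fun i => if i < m then
    q i * p i / (p i ^ 2 + lam * n) * q i / (γ * m + q i ^ 2) else 0) hcoord]
  apply ENNReal.ofReal_le_ofReal
  rw [Finset.mul_sum]
  refine le_trans ?_ (Finset.single_le_sum (fun j _ => ?_) (Finset.mem_univ (⟨0, hm⟩ : Fin m)))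
  · have hp0 : p 0 ^ 2 = n := by rw [hp, powerWeight_sq]; simp
    have hq0 : q 0 ^ 2 = m := by rw [hq, powerWeight_sq]; simp
    simp only [hm, if_true, ← hi₀]
    have hinner : inner ℝ (e i₀) (R • e i₀) = R := by
      rw [inner_smul_right, real_inner_self_eq_norm_sq, e.norm_eq_one]; simp
    have hs : q 0 * p 0 / (p 0 ^ 2 + lam * n) * q 0 / (γ * m + q 0 ^ 2) * p 0 =
        1 / ((1 + lam) * (1 + γ)) := by
      have : q 0 * p 0 / (p 0 ^ 2 + lam * n) * q 0 / (γ * m + q 0 ^ 2) * p 0 =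
        q 0 ^ 2 * p 0 ^ 2 / (p 0 ^ 2 + lam * n) / (γ * m + q 0 ^ 2) := by ring
      rw [this, hp0, hq0]
      field_simp
      ring
    rw [hs, hinner, hq0]
    have h1 : 1 / ((1 + lam) * (1 + γ)) ≤ 1 / (1 + lam) := by
      apply one_div_le_one_div_of_le (by positivity)
      nlinarith [mul_pos hlam hγ]
    have h2 : lam / (1 + lam) = 1 - 1 / (1 + lam) := by field_simp; ring
    have h3 : 0 ≤ lam / (1 + lam) := by positivity
    have h4 : (lam / (1 + lam)) ^ 2 ≤ (1 / ((1 + lam) * (1 + γ)) - 1) ^ 2 := by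
      rw [← neg_sq (1 / ((1 + lam) * (1 + γ)) - 1)]
      gcongr
      linarith
    rw [← mul_assoc, one_div_mul_cancel hmR.ne', one_mul]
    have h5 := mul_le_mul_of_nonneg_right h4 (sq_nonneg R)
    nlinarith [mul_nonneg (sq_nonneg (q 0 * p 0 / (p 0 ^ 2 + lam * n) * q 0 /
      (γ * m + m))) (sq_nonneg σ)]
  · positivity

end Power

/-! ### Minimax lower bound -/

/-- At least `k / 2` and at most `k` of the positions `1, …, n` lie in `[k / 2, k]`. -/
theorem sum_block_bounds {n k : ℕ} (hk : 1 ≤ k) (hkn : k ≤ n) :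
    (k : ℝ) / 2 ≤ ∑ i : Fin n, (if k ≤ 2 * ((i : ℕ) + 1) ∧ (i : ℕ) + 1 ≤ k then (1 : ℝ) else 0) ∧
    ∑ i : Fin n, (if k ≤ 2 * ((i : ℕ) + 1) ∧ (i : ℕ) + 1 ≤ k then (1 : ℝ) else 0) ≤ k := by
  rw [Fin.sum_univ_eq_sum_range (fun i => if k ≤ 2 * (i + 1) ∧ i + 1 ≤ k then (1 : ℝ) else 0),
    Finset.sum_boole]
  have : (Finset.range n).filter (fun i => k ≤ 2 * (i + 1) ∧ i + 1 ≤ k) =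
      Finset.Ico ((k + 1) / 2 - 1) k := by
    ext i
    simp only [Finset.mem_filter, Finset.mem_range, Finset.mem_Ico]
    omega
  rw [this, Nat.card_Ico]
  constructor
  · rw [div_le_iff₀ two_pos]
    have : k ≤ (k - ((k + 1) / 2 - 1)) * 2 := by omega
    exact_mod_cast this
  · exact_mod_cast Nat.sub_le _ _

section Power

variable {X H : Type*} [NormedAddCommGroup H] [InnerProductSpace ℝ H] [RKHS ℝ H X ℝ]
  {n : ℕ} {hnn : n ≤ n} {e : OrthonormalBasis (Fin n) ℝ H} {x xt : Fin n → X} {α β : ℝ}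

/-- Assouad's bound over the coordinates in `[k / 2, k]`, where `k` is beyond the cutoff: there the
signals `± ε` with `ε² = 4 ^ (-α) R² / k` cannot be told apart. -/
theorem IsDiagonalDesign.le_iSup_mse_of_cutoff_le
    (D : IsDiagonalDesign hnn e x xt (powerWeight n α) (powerWeight n β))
    (hα : 0 < α) (hβ : 0 < β) {R σ : ℝ} (hR : 0 < R) (hσ : 0 < σ)
    {k : ℕ} (hk : 1 ≤ k) (hkn : k ≤ n) (hkσ : R ^ 2 * n / σ ^ 2 ≤ (k : ℝ) ^ (2 * α + 1))
    {fhat : (Fin n → ℝ) → X → ℝ} (hf : ∀ j, Measurable fun y => fhat y (xt j)) :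
    ENNReal.ofReal ((√(2 * Real.pi))⁻¹ * Real.exp (-2) * 4 ^ (-α) * R ^ 2 * (k : ℝ) ^ (-2 * β)) ≤
      ⨆ (fstar : H) (_ : ‖fstar‖ ≤ R),
        mse (fun _ => gaussianReal 0 (Real.toNNReal (σ ^ 2))) x xt fhat fstar := by
  have hn : 0 < n := by omega
  have hnR : (0 : ℝ) < n := by exact_mod_cast hn
  have hkR : (0 : ℝ) < k := by exact_mod_cast hk
  set p := powerWeight n α with hp
  set q := powerWeight n β with hq
  set E := 4 ^ (-α) * R ^ 2 / k with hE
  have hE0 : 0 < E := by positivity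
  set ε : Fin n → ℝ := fun i => if k ≤ 2 * ((i : ℕ) + 1) ∧ (i : ℕ) + 1 ≤ k then √E else 0 with hε
  have hεsq : ∀ i : Fin n, ε i ^ 2 =
      E * (if k ≤ 2 * ((i : ℕ) + 1) ∧ (i : ℕ) + 1 ≤ k then 1 else 0) := by
    intro i
    simp only [hε]
    split_ifs
    · rw [Real.sq_sqrt hE0.le, mul_one]
    · simp
  obtain ⟨hlow, hup⟩ := sum_block_bounds hk hkn
  have hs : ∀ i : Fin n, |p i * ε i| ≤ σ := by
    intro i
    refine abs_le_of_sq_le_sq ?_ hσ.le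
    rw [mul_pow, hεsq, hp, powerWeight_sq]
    split_ifs with h
    · have hki : (k : ℝ) / 2 ≤ (i : ℝ) + 1 := by
        rw [div_le_iff₀ two_pos]
        have := h.1
        have h' : (k : ℝ) ≤ 2 * ((i : ℝ) + 1) := by exact_mod_cast this
        linarith
      have h1 : ((i : ℝ) + 1) ^ (-2 * α) ≤ ((k : ℝ) / 2) ^ (-2 * α) :=
        Real.rpow_le_rpow_of_nonpos (by positivity) hki (by linarith)
      have h2 : ((k : ℝ) / 2) ^ (-2 * α) = 4 ^ α * (k : ℝ) ^ (-2 * α) := by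
        rw [Real.div_rpow hkR.le (by norm_num), div_eq_mul_inv, ← Real.rpow_neg (by norm_num),
          show (4 : ℝ) = 2 ^ (2 : ℝ) by norm_num, ← Real.rpow_mul (by norm_num)]
        ring_nf
      calc n * ((i : ℝ) + 1) ^ (-2 * α) * (E * 1)
          ≤ n * (4 ^ α * (k : ℝ) ^ (-2 * α)) * (E * 1) := by rw [← h2]; gcongr
        _ = R ^ 2 * n / (k : ℝ) ^ (2 * α + 1) := by
            rw [hE, neg_mul, Real.rpow_neg hkR.le, Real.rpow_neg (by norm_num),
              Real.rpow_add_one hkR.ne']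
            field_simp
        _ ≤ σ ^ 2 := by
            rw [div_le_iff₀ (by positivity)] at hkσ ⊢
            linarith
    · rw [mul_zero, mul_zero]; positivity
  obtain ⟨τ, hτ⟩ := hypercube_lower_bound hσ (s := fun i => p i * ε i) (d := fun j => q j * ε j)
    hs (g := fun j y => fhat y (xt j)) hf
  have hτsq : ∀ i, ((τ i : ℤ) : ℝ) ^ 2 = 1 := by
    intro i
    rcases Int.units_eq_one_or (τ i) with h | h <;> simp [h]
  set fstar : H := e.repr.symm (WithLp.toLp 2 fun i => ((τ i : ℤ) : ℝ) * ε i) with hfstar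
  have hcoord : ∀ i, inner ℝ (e i) fstar = ((τ i : ℤ) : ℝ) * ε i := by
    intro i
    rw [← e.repr_apply_apply, hfstar]
    simp
  have hnorm : ‖fstar‖ ≤ R := by
    rw [← sq_le_sq₀ (norm_nonneg _) hR.le, ← e.sum_sq_norm_inner_right fstar]
    calc ∑ i, ‖inner ℝ (e i) fstar‖ ^ 2
        = E * ∑ i : Fin n, (if k ≤ 2 * ((i : ℕ) + 1) ∧ (i : ℕ) + 1 ≤ k then (1 : ℝ) else 0) := by
          rw [Finset.mul_sum]
          refine Finset.sum_congr rfl fun i _ => ?_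
          rw [hcoord, Real.norm_eq_abs, sq_abs, mul_pow, hτsq, hεsq, one_mul]
      _ ≤ E * k := by gcongr
      _ = 4 ^ (-α) * R ^ 2 := by rw [hE]; field_simp
      _ ≤ 1 * R ^ 2 := by
          gcongr
          exact Real.rpow_le_one_of_one_le_of_nonpos (by norm_num) (by linarith)
      _ = R ^ 2 := one_mul _
  refine le_iSup₂_of_le fstar hnorm ?_
  have hmse : mse (fun _ => gaussianReal 0 (Real.toNNReal (σ ^ 2))) x xt fhat fstar =
      ENNReal.ofReal (1 / (n : ℝ)) * ∫⁻ w, ENNReal.ofReal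
        (∑ j, (fhat (fun i => ((τ i : ℤ) : ℝ) * (p i * ε i) + w i) (xt j)
          - ((τ j : ℤ) : ℝ) * (q j * ε j)) ^ 2)
        ∂Measure.pi fun _ => gaussianReal 0 (Real.toNNReal (σ ^ 2)) := by
    rw [mse, ← lintegral_const_mul']
    · refine lintegral_congr fun w => ?_
      rw [← ENNReal.ofReal_mul (by positivity)]
      congr 2
      refine Finset.sum_congr rfl fun j _ => ?_
      have h1 : (fun i => fstar (x i) + w i) =
          fun i => ((τ i : ℤ) : ℝ) * (p i * ε i) + w i := by
        funext i
        rw [D.source, hcoord]; ring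
      rw [h1, D.target, Fin.castLE_rfl, id_eq, hcoord]
      ring
    · exact ENNReal.ofReal_ne_top
  rw [hmse]
  refine le_trans ?_ (mul_le_mul_right hτ _)
  rw [← ENNReal.ofReal_mul (by positivity)]
  apply ENNReal.ofReal_le_ofReal
  have hterm : ∀ j : Fin n, n * (E * (k : ℝ) ^ (-2 * β)) *
      (if k ≤ 2 * ((j : ℕ) + 1) ∧ (j : ℕ) + 1 ≤ k then (1 : ℝ) else 0) ≤ (q j * ε j) ^ 2 := by
    intro j
    rw [mul_pow, hεsq, hq, powerWeight_sq]
    split_ifs with h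
    · have hjk : (j : ℝ) + 1 ≤ k := by exact_mod_cast h.2
      have h1 : (k : ℝ) ^ (-2 * β) ≤ ((j : ℝ) + 1) ^ (-2 * β) :=
        Real.rpow_le_rpow_of_nonpos (by positivity) hjk (by linarith)
      calc n * (E * (k : ℝ) ^ (-2 * β)) * 1 = n * (k : ℝ) ^ (-2 * β) * (E * 1) := by ring
        _ ≤ _ := by gcongr
    · simp
  have hsum : n * (E * (k : ℝ) ^ (-2 * β)) * ((k : ℝ) / 2) ≤ ∑ j : Fin n, (q j * ε j) ^ 2 := by
    refine le_trans ?_ (Finset.sum_le_sum fun j _ => hterm j)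
    rw [← Finset.mul_sum]
    gcongr
  calc _ = 1 / (n : ℝ) * (2 * (√(2 * Real.pi))⁻¹ * Real.exp (-2) *
        (n * (E * (k : ℝ) ^ (-2 * β)) * ((k : ℝ) / 2))) := by
        rw [hE]; field_simp
    _ ≤ _ := by gcongr

/-- The minimax lower bound, in terms of the cutoff `J`. -/
theorem IsDiagonalDesign.le_iSup_mse
    (D : IsDiagonalDesign hnn e x xt (powerWeight n α) (powerWeight n β))
    (hα : 0 < α) (hβ : 0 < β) {R σ J : ℝ} (hR : 0 < R) (hσ : 0 < σ) (hJ : 0 < J)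
    (hJn : J ≤ n) (hJσ : R ^ 2 * n / σ ^ 2 = J ^ (2 * α + 1))
    {fhat : (Fin n → ℝ) → X → ℝ} (hf : ∀ j, Measurable fun y => fhat y (xt j)) :
    ENNReal.ofReal ((√(2 * Real.pi))⁻¹ * Real.exp (-2) * 4 ^ (-α) * 4 ^ (-β) *
        min (R ^ 2 * J ^ (-2 * β)) (R ^ 2)) ≤
      ⨆ (fstar : H) (_ : ‖fstar‖ ≤ R),
        mse (fun _ => gaussianReal 0 (Real.toNNReal (σ ^ 2))) x xt fhat fstar := by
  set k := ⌈J⌉₊ with hkdef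
  have hJk : J ≤ k := Nat.le_ceil J
  have hk1 : 1 ≤ k := Nat.ceil_pos.2 hJ
  have hkn : k ≤ n := Nat.ceil_le.2 hJn
  have hkJ : (k : ℝ) ≤ J + 1 := (Nat.ceil_lt_add_one hJ.le).le
  refine le_trans (ENNReal.ofReal_le_ofReal ?_) (D.le_iSup_mse_of_cutoff_le hα hβ hR hσ hk1 hkn
    (by rw [hJσ]; gcongr) hf)
  have hkR : (0 : ℝ) < k := by exact_mod_cast hk1
  have h4 : (4 : ℝ) ^ (-β) = 2 ^ (-2 * β) := by
    rw [show (4 : ℝ) = 2 ^ (2 : ℝ) by norm_num, ← Real.rpow_mul (by norm_num)]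
    ring_nf
  have key : 4 ^ (-β) * min (R ^ 2 * J ^ (-2 * β)) (R ^ 2) ≤ R ^ 2 * (k : ℝ) ^ (-2 * β) := by
    rcases le_or_gt 1 J with h | h
    · calc 4 ^ (-β) * min (R ^ 2 * J ^ (-2 * β)) (R ^ 2)
          ≤ 4 ^ (-β) * (R ^ 2 * J ^ (-2 * β)) := by gcongr; exact min_le_left _ _
        _ = R ^ 2 * (2 * J) ^ (-2 * β) := by
            rw [Real.mul_rpow (by norm_num) hJ.le, h4]; ring
        _ ≤ _ := by
            gcongr R ^ 2 * ?_
            exact Real.rpow_le_rpow_of_nonpos hkR (by linarith) (by linarith)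
    · calc 4 ^ (-β) * min (R ^ 2 * J ^ (-2 * β)) (R ^ 2)
          ≤ 4 ^ (-β) * R ^ 2 := by gcongr; exact min_le_right _ _
        _ = R ^ 2 * 2 ^ (-2 * β) := by rw [h4]; ring
        _ ≤ _ := by
            gcongr R ^ 2 * ?_
            exact Real.rpow_le_rpow_of_nonpos hkR (by linarith) (by linarith)
  calc _ = (√(2 * Real.pi))⁻¹ * Real.exp (-2) * 4 ^ (-α) *
        (4 ^ (-β) * min (R ^ 2 * J ^ (-2 * β)) (R ^ 2)) := by ring
    _ ≤ (√(2 * Real.pi))⁻¹ * Real.exp (-2) * 4 ^ (-α) * (R ^ 2 * (k : ℝ) ^ (-2 * β)) := by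
        gcongr
    _ = _ := by ring

end Power

/-! ### Existence of diagonal designs -/

/-- A Hilbert space as the RKHS of its continuous linear functionals, regarded as functions on the
space itself; the kernel is the inner product. -/
noncomputable abbrev linearRKHS (E : Type*) [NormedAddCommGroup E] [InnerProductSpace ℝ E] :
    RKHS ℝ E E ℝ where
  coeCLM := ContinuousLinearMap.pi fun s => innerSL ℝ s
  coeCLM_injective f g h := ext_inner_left ℝ fun v => by simpa using congrFun h v

theorem isDiagonalDesign_linearRKHS {n m : ℕ} (hmn : m ≤ n) (p q : ℕ → ℝ) :
    letI := linearRKHS (EuclideanSpace ℝ (Fin n))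
    IsDiagonalDesign hmn (EuclideanSpace.basisFun (Fin n) ℝ)
      (fun i => p i • EuclideanSpace.basisFun (Fin n) ℝ i)
      (fun j => q j • EuclideanSpace.basisFun (Fin n) ℝ (Fin.castLE hmn j)) p q := by
  let _ := linearRKHS (EuclideanSpace ℝ (Fin n))
  have heval : ∀ f s : EuclideanSpace ℝ (Fin n),
      (RKHS.instFunLike (H := EuclideanSpace ℝ (Fin n))).coe f s = inner ℝ s f := fun _ _ => rfl
  constructor
  · intro f i
    exact (heval _ _).trans (by rw [inner_smul_left]; simp)
  · intro f j
    exact (heval _ _).trans (by rw [inner_smul_left]; simp)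

end KernelTransfer

theorem theorem2 (α β : ℝ) (hα : 1 / 2 < α) (hβ : 1 / 2 < β) (hβα : β < 1 / 2 + α) :
    ∃ a b c c₂ : ℝ, 0 < a ∧ a ≤ b ∧ 0 < c ∧ 0 < c₂ ∧
    ∀ lam : ℝ, 0 < lam →
    ∃ c₀ c₁ : ℝ, 0 < c₀ ∧ 0 < c₁ ∧
    ∀ n m : ℕ, lam ^ (-1 - 1 / (2 * α)) ≤ (n : ℝ) → 1 ≤ m → m ≤ n →
    ∃ (X H : Type) (_ : NormedAddCommGroup H) (_ : InnerProductSpace ℝ H)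
      (_ : CompleteSpace H) (_ : RKHS ℝ H X ℝ) (x : Fin n → X) (xt : Fin m → X),
      -- `(α, β)`-eigendecay of the source and target kernel matrices
      KernelTransfer.HasEigendecay ((1 / (n : ℝ)) • KernelTransfer.kernelMatrix H x x) α a b ∧
      KernelTransfer.HasEigendecay ((1 / (m : ℝ)) • KernelTransfer.kernelMatrix H xt xt) β a b ∧
      -- both estimators are well defined
      (∀ γ : ℝ, 0 < γ → ∀ y : Fin n → ℝ,
        (∀ η : ℝ, 0 < η → ∃! f : H, KernelTransfer.IsRaTEstimate
          (KernelTransfer.ridgeTeacher H x xt lam) x xt γ η y f) ∧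
        (∃! f : H, KernelTransfer.IsSMEstimate
          (KernelTransfer.ridgeTeacher H x xt lam) xt γ y f)) ∧
      ∀ R σ : ℝ, 1 ≤ R → 0 < σ →
        (∀ ν : Fin n → Measure ℝ, (∀ i, KernelTransfer.IsNoiseLaw (ν i) σ) →
          -- upper bound for the residual-as-teacher estimate
          (∀ (η : ℝ) (fRaT : (Fin n → ℝ) → H), 0 < η →
            (∀ y, KernelTransfer.IsRaTEstimate (KernelTransfer.ridgeTeacher H x xt lam) x xt
              (1 / lam * (σ ^ 2 / (R ^ 2 * n)) ^ (2 * (α + β) / (2 * α + 1))) η y (fRaT y)) →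
            ∀ fstar : H, ‖fstar‖ ≤ R →
              KernelTransfer.mse ν x xt (fun y => fRaT y) fstar ≤
                ENNReal.ofReal
                  (c₀ * R ^ 2 * (σ ^ 2 / (n * R ^ 2)) ^ (2 * β / (2 * α + 1))) ∧
              -- for `σ ≤ R` the constant does not depend on `lam` either
              (σ ≤ R →
                KernelTransfer.mse ν x xt (fun y => fRaT y) fstar ≤
                  ENNReal.ofReal
                    (c * R ^ 2 * (σ ^ 2 / (n * R ^ 2)) ^ (2 * β / (2 * α + 1))))) ∧
          -- lower bound for the soft-matching estimates, whatever the choice of `γ`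
          (∀ fSM : ℝ → (Fin n → ℝ) → H,
            (∀ γ : ℝ, 0 < γ → ∀ y, KernelTransfer.IsSMEstimate
              (KernelTransfer.ridgeTeacher H x xt lam) xt γ y (fSM γ y)) →
            ENNReal.ofReal (c₁ * R ^ 2) ≤
              (⨆ (fstar : H) (_ : ‖fstar‖ ≤ R), ⨅ (γ : ℝ) (_ : 0 < γ),
                KernelTransfer.mse ν x xt (fun y => fSM γ y) fstar))) ∧
        -- minimax lower bound over all estimators, under Gaussian noise
        (m = n → (R ^ 2 / σ ^ 2) ^ (1 / (2 * α)) ≤ (n : ℝ) →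
          ∀ fhat : (Fin n → ℝ) → X → ℝ, (∀ j, Measurable fun y => fhat y (xt j)) →
            ENNReal.ofReal
                (c₂ * min (R ^ 2 * (σ ^ 2 / (n * R ^ 2)) ^ (2 * β / (2 * α + 1))) (R ^ 2)) ≤
              (⨆ (fstar : H) (_ : ‖fstar‖ ≤ R),
                KernelTransfer.mse (fun _ => gaussianReal 0 (Real.toNNReal (σ ^ 2))) x xt
                  fhat fstar)) := by
  obtain ⟨C, hC0, hC⟩ := KernelTransfer.exists_sum_rpow_mul_min_le
    (p := 2 * α - 2 * β) (k := 2 * (α + β)) (by linarith) (by linarith)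
  have hα0 : 0 < α := by linarith
  have hβ0 : 0 < β := by linarith
  have h2α : 0 < 2 * α + 1 := by linarith
  -- the eigenvalues are exactly `j ^ (-2 α)` and `j ^ (-2 β)`, so `a = b = 1`
  refine ⟨1, 1, 2 + C, (√(2 * Real.pi))⁻¹ * Real.exp (-2) * 4 ^ (-α) * 4 ^ (-β),
    one_pos, le_rfl, by positivity, by positivity, fun lam hlam => ?_⟩
  refine ⟨1 + 1 / lam + C, (lam / (1 + lam)) ^ 2, by positivity, by positivity,
    fun n m hnlam hm hmn => ?_⟩
  have hn : 0 < n := lt_of_lt_of_le hm hmn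
  have hnR : (0 : ℝ) < n := by exact_mod_cast hn
  have hmR : (0 : ℝ) < m := by exact_mod_cast hm
  let _ := KernelTransfer.linearRKHS (EuclideanSpace ℝ (Fin n))
  have D := KernelTransfer.isDiagonalDesign_linearRKHS hmn
    (KernelTransfer.powerWeight n α) (KernelTransfer.powerWeight m β)
  refine ⟨EuclideanSpace ℝ (Fin n), EuclideanSpace ℝ (Fin n), inferInstance, inferInstance,
    inferInstance, KernelTransfer.linearRKHS _, _, _, D.hasEigendecay_source hn hα0.le,
    D.hasEigendecay_target hm hβ0.le, fun γ hγ y => ⟨fun η hη => ?_, ?_⟩,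
    fun R σ hR1 hσ => ⟨fun ν hν => ⟨fun η fRaT hη hf fstar hstar => ?_, fun fSM hf => ?_⟩,
      fun hmeq hnσ fhat hfhat => ?_⟩⟩
  · exact (existsUnique_congr fun f =>
      (D.isRaTEstimate_iff (by positivity) (by positivity) hη y f)).2
      (KernelTransfer.existsUnique_inner_eq _ _)
  · exact (existsUnique_congr fun f =>
      (D.isSMEstimate_iff (by positivity) (by positivity) y f)).2
      (KernelTransfer.existsUnique_inner_eq _ _)
  · have hR : 0 < R := by linarith
    set δ := σ ^ 2 / (R ^ 2 * n) with hδ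
    have hδ0 : 0 < δ := by positivity
    set J := δ ^ (-1 / (2 * α + 1)) with hJdef
    have hJ : 0 < J := by positivity
    have hJpow : ∀ r : ℝ, J ^ (-r) = δ ^ (r / (2 * α + 1)) := by
      intro r
      rw [hJdef, ← Real.rpow_mul hδ0.le]
      congr 1; ring
    have hδ' : σ ^ 2 / (n * R ^ 2) = δ := by rw [hδ, mul_comm]
    have hJσ : σ ^ 2 / n = R ^ 2 * J ^ (-(2 * α + 1)) := by
      rw [hJpow, div_self h2α.ne', Real.rpow_one, hδ]
      field_simp
    rw [← hJpow, ← neg_mul] at hf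
    have hmain := D.mse_rat_le hm hα0 hβ0 hC hlam hR hJ hη hJσ hν hf hstar
    rw [hδ', ← hJpow, ← neg_mul]
    refine ⟨hmain.trans (ENNReal.ofReal_le_ofReal ?_),
      fun hσR => hmain.trans (ENNReal.ofReal_le_ofReal ?_)⟩
    · gcongr
      exact min_le_left _ _
    · have hJlam : J ^ (-2 * α) ≤ lam := by
        have h1 : δ ≤ (n : ℝ)⁻¹ := by
          rw [hδ, div_le_iff₀ (by positivity), inv_mul_eq_div, mul_div_cancel_right₀ _ hnR.ne']
          gcongr
        have h2 : (n : ℝ)⁻¹ ≤ lam ^ (1 + 1 / (2 * α)) := by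
          rw [inv_le_comm₀ hnR (by positivity), ← Real.rpow_neg hlam.le]
          refine le_trans (le_of_eq ?_) hnlam
          congr 1; ring
        calc J ^ (-2 * α) = δ ^ (2 * α / (2 * α + 1)) := by rw [neg_mul, hJpow]
          _ ≤ (lam ^ (1 + 1 / (2 * α))) ^ (2 * α / (2 * α + 1)) := by
              gcongr
              exact h1.trans h2
          _ = lam := by
              rw [← Real.rpow_mul hlam.le]
              have : (1 + 1 / (2 * α)) * (2 * α / (2 * α + 1)) = 1 := by field_simp
              rw [this, Real.rpow_one]
      gcongr
      have : min 1 (J ^ (-2 * α)) / lam ≤ 1 :=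
        (div_le_one hlam).2 ((min_le_right _ _).trans hJlam)
      linarith
  · exact D.le_iSup_iInf_mse_sm hm hlam (by linarith) hν hf
  · subst hmeq
    have hR : 0 < R := by linarith
    set δ := σ ^ 2 / (m * R ^ 2) with hδ
    have hδ0 : 0 < δ := by positivity
    set J := δ ^ (-1 / (2 * α + 1)) with hJdef
    have hJ : 0 < J := by positivity
    have hJpow : J ^ (-2 * β) = δ ^ (2 * β / (2 * α + 1)) := by
      rw [hJdef, ← Real.rpow_mul hδ0.le]
      congr 1; ring
    have hJσ : R ^ 2 * m / σ ^ 2 = J ^ (2 * α + 1) := by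
      rw [hJdef, ← Real.rpow_mul hδ0.le, div_mul_cancel₀ _ h2α.ne', Real.rpow_neg_one, hδ, inv_div,
        mul_comm]
    have hJm : J ≤ m := by
      rw [← Real.rpow_le_rpow_iff hJ.le hmR.le h2α, ← hJσ, Real.rpow_add_one hmR.ne',
        mul_div_right_comm]
      gcongr
      calc R ^ 2 / σ ^ 2 = ((R ^ 2 / σ ^ 2) ^ (1 / (2 * α))) ^ (2 * α) := by
            rw [← Real.rpow_mul (by positivity), one_div_mul_cancel (by positivity),
              Real.rpow_one]
        _ ≤ _ := by gcongr
    rw [← hJpow]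
    exact D.le_iSup_mse hα0 hβ0 hR hσ hJ hJm hJσ hfhat
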